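/- An instance $(G,T,\ell)$ of the 0-Extension with Steiner Nodes problem consists of a finite undirected graph $G=(V,E)$ with capacities $c(e)\ge 0$ and lengths $\ell_e\ge 0$ on its edges $e\in E$, and a set $T\subseteq V$ of terminals, every two of which are connected by a path in $G$. Let $\mathrm{dist}_\ell(u,v)$ denote the shortest-path distance between $u$ and $v$ in $G$ with respect to $\ell$. A solution $(\mathcal F,\delta)$ of the instance consists of a partition $\mathcal F$ of $V$ such that distinct terminals lie in different sets of $\mathcal F$, and a semi-metric $\delta$ on $\mathcal F$ (nonnegative, symmetric, zero on the diagonal, satisfying the triangle inequality; distinct sets may be at distance $0$) such that $\delta(F(t),F(t'))=\mathrm{dist}_\ell(t,t')$ for all $t,t'\in T$, where $F(u)\in\mathcal F$ denotes the set that contains $u$. **Theorem.** For every instance $(G,T,\ell)$ with $|T|\le 5$ there is a solution $(\mathcal F,\delta)$ such that $|\mathcal F|\le 30$ and $$\sum_{(u,v)\in E}c(u,v)\cdot\delta(F(u),F(v))=\sum_{(u,v)\in E}c(u,v)\cdot\mathrm{dist}_\ell(u,v).$$ -/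

import Mathlib

namespace ZeroExt

/-- The total length of a walk whose edges `e` have length `len e`. -/
def walkLength {V : Type*} {G : SimpleGraph V} (len : Sym2 V → ℝ) {u v : V}
    (p : G.Walk u v) : ℝ :=
  (p.edges.map len).sum

/-- The shortest-path distance between `u` and `v` in `G` for the edge lengths `len`: the infimum of
the lengths of all walks from `u` to `v`. It is used below only for nonnegative lengths (so that
walks may replace paths) and for vertices `u`, `v` that are joined by a walk. -/
noncomputable def pathDist {V : Type*} (G : SimpleGraph V) (len : Sym2 V → ℝ) (u v : V) : ℝ :=
  ⨅ p : G.Walk u v, walkLength len p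

theorem pathDist_comm {V : Type*} (G : SimpleGraph V) (len : Sym2 V → ℝ) (u v : V) :
    pathDist G len u v = pathDist G len v u := by
  unfold pathDist
  let e : G.Walk u v ≃ G.Walk v u :=
    ⟨fun p => p.reverse, fun p => p.reverse, fun p => p.reverse_reverse, fun p => p.reverse_reverse⟩
  refine Equiv.iInf_congr e ?_
  intro p
  simp [e, walkLength]

/-- An instance of the 0-Extension-with-Steiner-Nodes problem on the finite vertex set `V`: an
undirected graph with nonnegative edge capacities and nonnegative edge lengths, and a set of
terminals. Every two terminals are joined by a walk, so their shortest-path distance is finite. The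
values of `cap` and `len` outside the edge set of the graph play no role. -/
structure Instance (V : Type*) [Fintype V] [DecidableEq V] where
  graph : SimpleGraph V
  cap : Sym2 V → ℝ
  len : Sym2 V → ℝ
  terminals : Finset V
  cap_nonneg : ∀ e ∈ graph.edgeSet, 0 ≤ cap e
  len_nonneg : ∀ e ∈ graph.edgeSet, 0 ≤ len e
  reachable : ∀ t ∈ terminals, ∀ t' ∈ terminals, graph.Reachable t t'

/-- The shortest-path distance of an instance. -/
noncomputable def Instance.dist {V : Type*} [Fintype V] [DecidableEq V] (I : Instance V)
    (u v : V) : ℝ :=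
  pathDist I.graph I.len u v

open Classical in
/-- The sum `∑_{(u,v) ∈ E} c(u,v) · w(u,v)` for a symmetric function `w` on pairs of vertices; each
undirected edge is counted once. -/
noncomputable def Instance.edgeSum {V : Type*} [Fintype V] [DecidableEq V] (I : Instance V)
    (w : V → V → ℝ) (hw : ∀ u v, w u v = w v u) : ℝ :=
  ∑ e ∈ I.graph.edgeFinset, I.cap e * Sym2.lift ⟨w, hw⟩ e

/-- The sum `∑_{(u,v) ∈ E} c(u,v) · dist(u,v)`. -/
noncomputable def Instance.distSum {V : Type*} [Fintype V] [DecidableEq V] (I : Instance V) : ℝ :=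
  I.edgeSum I.dist (pathDist_comm I.graph I.len)

/-- The cluster `F(u)` of a partition `F` of the vertex set that contains the vertex `u`. -/
def cluster {V : Type*} [Fintype V] [DecidableEq V] (F : Finpartition (Finset.univ : Finset V))
    (u : V) : {A : Finset V // A ∈ F.parts} :=
  ⟨F.part u, F.part_mem.2 (Finset.mem_univ u)⟩

/-- A semi-metric (pseudometric) on a type: a nonnegative symmetric function that vanishes on the
diagonal and satisfies the triangle inequality; distinct points may be at distance zero. -/
structure IsSemimetric {X : Type*} (δ : X → X → ℝ) : Prop where
  nonneg : ∀ x y, 0 ≤ δ x y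
  self : ∀ x, δ x x = 0
  symm : ∀ x y, δ x y = δ y x
  triangle : ∀ x y z, δ x z ≤ δ x y + δ y z

/-- A solution `(F, δ)` of an instance: a partition `F` of the vertex set that puts distinct
terminals into distinct clusters, and a semi-metric `δ` on the clusters that agrees with the
shortest-path distance on the clusters of terminals. -/
structure Solution {V : Type*} [Fintype V] [DecidableEq V] (I : Instance V) where
  F : Finpartition (Finset.univ : Finset V)
  δ : {A : Finset V // A ∈ F.parts} → {A : Finset V // A ∈ F.parts} → ℝ
  semimetric : IsSemimetric δ
  separates : ∀ t ∈ I.terminals, ∀ t' ∈ I.terminals, t ≠ t' → cluster F t ≠ cluster F t'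
  preserves : ∀ t ∈ I.terminals, ∀ t' ∈ I.terminals, δ (cluster F t) (cluster F t') = I.dist t t'

/-- The size `|F|` of a solution: its number of clusters. -/
def Solution.size {V : Type*} [Fintype V] [DecidableEq V] {I : Instance V} (S : Solution I) : ℕ :=
  S.F.parts.card

/-- The cost `∑_{(u,v) ∈ E} c(u,v) · δ(F(u),F(v))` of a solution. -/
noncomputable def Solution.cost {V : Type*} [Fintype V] [DecidableEq V] {I : Instance V}
    (S : Solution I) : ℝ :=
  I.edgeSum (fun u v => S.δ (cluster S.F u) (cluster S.F v)) (fun _ _ => S.semimetric.symm _ _)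

end ZeroExt

/-!
The shortest-path distances from a vertex `v` to the (at most) five terminals form a function on the
terminals; a `1`-Lipschitz retraction (`exists_retraction`) moves it into the tight span `Tight d`
of the metric `d` on the terminals, where the sup norm is the distance. So it is enough to round the
points of the tight span to few points, keeping the terminals fixed and without increasing a given
weighted sum of distances.

For five points the tight span is a two-dimensional complex that is built from strips and from one
rigid piece. Following Bandelt and Dress, the fifteen splits `{p, q} | rest` (with `p = q` allowed)
are split off from `d` one after the other, each with its isolation index as weight. Splitting off
a split contracts a strip of the tight span, and the sup distance decreases at least by the distance
travelled across the strip (`Tight.shrink_lipschitz`); this holds because one side of the split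
has at most two points. What remains has no splits any more, and it is a multiple of the metric of
the complete bipartite graph `K_{2,3}` (`IsPrime.exists_isK23`). Its tight span consists of three
triangles with a common side. Altogether `SplitDecomposition` gives each point of the tight span one
coordinate for each split and a position in these three triangles, and distances are at least the
sums of the differences of these.

The coordinate of a split is rounded to the ends of its range by a random threshold, and the
position in the triangles is rounded to one of their five vertices by a random threshold as well. On
average neither increases distances, so some choice of the thresholds does not increase the weighted
sum (`exists_threshold`, `IsK23.exists_rounding`). Few grid points are hit. Strips of disjoint pairs
do not meet, and the three pairings of four points cannot all be non-maximal, so that among the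
pairs of positive weight at most two meet in a point and no three form a triangle. This leaves at
most five points outside all strips, ten in exactly one strip and five in two strips; a point that
is rounded to the outer end of the leg of a trivial split is rounded to a terminal
(`exists_tightSpan_rounding`).

Together with the terminals these are twenty-five labels, and the cost is at most the sum of the
shortest-path distances. If some edge of positive capacity has an end that is not a terminal, a
further label for this vertex, which is moved away from all the others, makes up for the difference;
otherwise there is none (`exists_solution_of_label_le`).
-/

namespace ZeroExt

open Finset

/-! ### The tight span and its retraction -/

section TightSpan

variable {N : Type*}

/-- The points of the tight span (injective hull) of the semimetric `d`: functions `f` on the points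
of `d` with `d i j ≤ f i + f j` for all `i`, `j`, each coordinate of which is as small as the others
permit. The choice `i = j` is included, so `0 ≤ f i`. -/
structure Tight (d : N → N → ℝ) (f : N → ℝ) : Prop where
  le : ∀ i j, d i j ≤ f i + f j
  exists_eq : ∀ i, ∃ j, f i + f j = d i j

theorem Tight.nonneg {d : N → N → ℝ} (hd : IsSemimetric d) {f : N → ℝ} (hf : Tight d f) (i : N) :
    0 ≤ f i := by
  have := hf.le i i
  rw [hd.self] at this
  linarith

theorem Tight.le_add {d : N → N → ℝ} (hd : IsSemimetric d) {f : N → ℝ} (hf : Tight d f) (i j : N) :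
    f i ≤ f j + d i j := by
  obtain ⟨k, hk⟩ := hf.exists_eq i
  have := hf.le j k
  have := hd.triangle i j k
  linarith

theorem tight_row {d : N → N → ℝ} (hd : IsSemimetric d) (t : N) : Tight d (d t) where
  le i j := by
    have := hd.triangle i t j
    rw [hd.symm i t] at this
    exact this
  exists_eq i := ⟨t, by rw [hd.self, add_zero, hd.symm]⟩

/-- A point of the tight span at distance zero from `t` is the point `d t` itself. -/
theorem Tight.eq_row {d : N → N → ℝ} (hd : IsSemimetric d) {f : N → ℝ} (hf : Tight d f) {t : N}
    (ht : f t = 0) : f = d t := by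
  ext i
  have h1 := hf.le t i
  have h2 := hf.le_add hd i t
  rw [hd.symm i t] at h2
  linarith

/-- The upper set of `Tight d` is retracted onto `Tight d` by lowering the coordinates one after the
other. Each step is `1`-Lipschitz for the sup norm and keeps the coordinates that are tight. -/
theorem exists_retraction [Fintype N] [DecidableEq N] {d : N → N → ℝ} (hd : IsSemimetric d) :
    ∃ R : (N → ℝ) → N → ℝ,
      (∀ f, (∀ i j, d i j ≤ f i + f j) → Tight d (R f)) ∧
      (∀ f, Tight d f → R f = f) ∧
      ∀ f g M, (∀ i, |f i - g i| ≤ M) → ∀ i, |R f i - R g i| ≤ M := by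
  suffices H : ∀ s : Finset N, ∃ R : (N → ℝ) → N → ℝ,
      (∀ f, (∀ i j, d i j ≤ f i + f j) →
        (∀ i j, d i j ≤ R f i + R f j) ∧ ∀ i ∈ s, ∃ j, R f i + R f j = d i j) ∧
      (∀ f, Tight d f → R f = f) ∧
      ∀ f g M, (∀ i, |f i - g i| ≤ M) → ∀ i, |R f i - R g i| ≤ M by
    obtain ⟨R, h1, h2, h3⟩ := H univ
    exact ⟨R, fun f hf => ⟨(h1 f hf).1, fun i => (h1 f hf).2 i (mem_univ i)⟩, h2, h3⟩
  intro s
  induction s using Finset.induction_on with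
  | empty =>
    exact ⟨id, fun f hf => ⟨hf, fun i hi => absurd hi (notMem_empty i)⟩, fun _ _ => rfl,
      fun f g M h => h⟩
  | insert t s _ ih =>
    obtain ⟨R, h1, h2, h3⟩ := ih
    -- the least value of the coordinate `t` that the constraints at the other coordinates allow
    let low : (N → ℝ) → ℝ := fun f => univ.sup' ⟨t, mem_univ t⟩ fun s =>
      if s = t then 0 else d t s - f s
    have low_le : ∀ f c, 0 ≤ c → (∀ s ≠ t, d t s - f s ≤ c) → low f ≤ c := by
      intro f c hc h
      refine Finset.sup'_le _ _ fun s _ => ?_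
      split_ifs with hs
      · exact hc
      · exact h s hs
    have le_low : ∀ f, 0 ≤ low f := fun f => by
      have := Finset.le_sup' (fun s => if s = t then 0 else d t s - f s) (mem_univ t)
      simpa using this
    have le_low' : ∀ f, ∀ s ≠ t, d t s - f s ≤ low f := fun f s hs => by
      have := Finset.le_sup' (fun s => if s = t then 0 else d t s - f s) (mem_univ s)
      simpa [hs] using this
    have low_eq : ∀ f, low f = 0 ∨ ∃ s ≠ t, low f = d t s - f s := fun f => by
      obtain ⟨s, _, hs⟩ := Finset.exists_mem_eq_sup' (s := (univ : Finset N)) ⟨t, mem_univ t⟩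
        (fun s => if s = t then 0 else d t s - f s)
      by_cases h : s = t
      · left
        simpa [low, h] using hs
      · right
        exact ⟨s, h, by simpa [low, h] using hs⟩
    have low_lip : ∀ f g M, (∀ i, |f i - g i| ≤ M) → low f ≤ low g + M := by
      intro f g M h
      have hM : 0 ≤ M := (abs_nonneg _).trans (h t)
      refine low_le f _ (add_nonneg (le_low g) hM) fun s hs => ?_
      have := le_low' g s hs
      have := (abs_le.1 (h s)).1
      linarith
    refine ⟨fun f => Function.update (R f) t (low (R f)), fun f hf => ?_, fun f hf => ?_,
      fun f g M h i => ?_⟩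
    · obtain ⟨hP, hT⟩ := h1 f hf
      have low_le_self : low (R f) ≤ R f t := by
        refine low_le _ _ ?_ fun s _ => ?_
        · have := hP t t
          rw [hd.self] at this
          linarith
        · have := hP t s
          linarith
      refine ⟨fun i j => ?_, fun i hi => ?_⟩
      · by_cases hi : i = t <;> by_cases hj : j = t
        · subst hi; subst hj
          have := le_low (R f)
          simp [hd.self]
          linarith
        · subst hi
          have := le_low' (R f) j hj
          simp [hj]
          linarith
        · subst hj
          have := le_low' (R f) i hi
          rw [hd.symm] at this
          simp [hi]
          linarith
        · simpa [hi, hj] using hP i j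
      · by_cases hit : i = t
        · subst hit
          rcases low_eq (R f) with h0 | ⟨s, hs, h0⟩
          · exact ⟨i, by simp [h0, hd.self]⟩
          · exact ⟨s, by simp [h0, hs]⟩
        · obtain ⟨j, hj⟩ := hT i ((mem_insert.1 hi).resolve_left hit)
          refine ⟨j, ?_⟩
          by_cases hjt : j = t
          · subst hjt
            have := le_low' (R f) i hit
            rw [hd.symm] at this
            simp [hit]
            linarith
          · simpa [hit, hjt] using hj
    · show Function.update (R f) t (low (R f)) = f
      rw [h2 f hf]
      have : low f = f t := by
        refine le_antisymm (low_le _ _ (hf.nonneg hd t) fun s _ => ?_) ?_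
        · have := hf.le t s
          linarith
        · obtain ⟨s, hs⟩ := hf.exists_eq t
          by_cases hst : s = t
          · subst hst
            rw [hd.self] at hs
            have := le_low f
            linarith
          · have := le_low' f s hst
            linarith
      rw [this, Function.update_eq_self]
    · have h' := h3 f g M h
      by_cases hi : i = t
      · subst hi
        have e1 := low_lip _ _ M h'
        have e2 := low_lip (R g) (R f) M fun i => by rw [abs_sub_comm]; exact h' i
        simp only [Function.update_self]
        rw [abs_le]
        constructor <;> linarith
      · simpa [hi] using h' i

end TightSpan

/-! ### Splits and isolation indices -/

section Splits

variable {N : Type*} [DecidableEq N]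

/-- The side `{p, q}` of the split `{p, q} | N \ {p, q}` given by the pair `S = (p, q)`. For `p = q`
this is the trivial split `{p} | N \ {p}`. -/
def side (S : N × N) : Finset N := {S.1, S.2}

theorem mem_side {S : N × N} {i : N} : i ∈ side S ↔ i = S.1 ∨ i = S.2 := by
  simp [side]

theorem left_mem_side (S : N × N) : S.1 ∈ side S := by simp [side]

theorem right_mem_side (S : N × N) : S.2 ∈ side S := by simp [side]

/-- The cut semimetric of a split: `1` between points on different sides, `0` otherwise. -/
noncomputable def cutDist (S : N × N) (i j : N) : ℝ :=
  if (i ∈ side S ↔ j ∈ side S) then 0 else 1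

theorem cutDist_of_iff {S : N × N} {i j : N} (h : i ∈ side S ↔ j ∈ side S) :
    cutDist S i j = 0 := if_pos h

theorem cutDist_of_mem_of_notMem {S : N × N} {i j : N} (hi : i ∈ side S) (hj : j ∉ side S) :
    cutDist S i j = 1 := if_neg (by tauto)

theorem cutDist_of_notMem_of_mem {S : N × N} {i j : N} (hi : i ∉ side S) (hj : j ∈ side S) :
    cutDist S i j = 1 := if_neg (by tauto)

/-- The pairing `p q | i j` has the largest sum of distances among the three pairings of the points
`p`, `q`, `i`, `j`. -/
def MaxPairing (d : N → N → ℝ) (p q i j : N) : Prop :=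
  d p i + d q j ≤ d p q + d i j ∧ d p j + d q i ≤ d p q + d i j

/-- The pairing `p q | i j` does not have a strictly larger sum of distances than the other two
pairings of the points `p`, `q`, `i`, `j`. -/
def NotStrictMax (d : N → N → ℝ) (p q i j : N) : Prop :=
  d p q + d i j ≤ max (d p i + d q j) (d p j + d q i)

/-- `α` is the isolation index of the split `S` in the semimetric `d`: the largest `α ≥ 0` for which
`α` times the cut semimetric of `S` can be split off from `d`. -/
structure IsIsolationIndex (d : N → N → ℝ) (S : N × N) (α : ℝ) : Prop where
  nonneg : 0 ≤ α
  le : α = 0 ∨ ∀ i j, i ∉ side S → j ∉ side S → i ≠ j →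
    d S.1 S.2 + d i j + 2 * α ≤ max (d S.1 i + d S.2 j) (d S.1 j + d S.2 i)
  attained : ∃ i j, i ∉ side S ∧ j ∉ side S ∧ i ≠ j ∧
    max (d S.1 i + d S.2 j) (d S.1 j + d S.2 i) ≤ d S.1 S.2 + d i j + 2 * α

/-- The semimetric that is left of `d` when `α` times the cut semimetric of `S` is removed. -/
noncomputable def peel (d : N → N → ℝ) (S : N × N) (α : ℝ) (i j : N) : ℝ :=
  d i j - α * cutDist S i j

theorem exists_ne_notMem_side [Fintype N] (hN : 4 ≤ Fintype.card N) (S : N × N) (i : N) :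
    ∃ j, j ∉ side S ∧ i ≠ j := by
  have h1 : (insert i (side S)).card < Fintype.card N := by
    have := card_insert_le i (side S)
    have : (side S).card ≤ 2 := card_le_two
    omega
  obtain ⟨j, hj⟩ : ∃ j, j ∉ insert i (side S) := by
    by_contra! h
    have : insert i (side S) = univ := eq_univ_iff_forall.2 h
    rw [this, card_univ] at h1
    exact lt_irrefl _ h1
  rw [mem_insert, not_or] at hj
  exact ⟨j, hj.2, fun h => hj.1 h.symm⟩

theorem exists_isIsolationIndex [Fintype N] (hN : 4 ≤ Fintype.card N) (d : N → N → ℝ) (S : N × N) :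
    ∃ α, IsIsolationIndex d S α := by
  obtain ⟨i₀, hi₀, -⟩ := exists_ne_notMem_side hN S S.1
  obtain ⟨j₀, hj₀, hij₀⟩ := exists_ne_notMem_side hN S i₀
  let T : Finset (N × N) := univ.filter fun e => e.1 ∉ side S ∧ e.2 ∉ side S ∧ e.1 ≠ e.2
  let φ : N × N → ℝ := fun e =>
    max (d S.1 e.1 + d S.2 e.2) (d S.1 e.2 + d S.2 e.1) - (d S.1 S.2 + d e.1 e.2)
  obtain ⟨e, he, hmin⟩ := T.exists_min_image φ ⟨(i₀, j₀), by simp [T, hi₀, hj₀, hij₀]⟩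
  have he' : e.1 ∉ side S ∧ e.2 ∉ side S ∧ e.1 ≠ e.2 := by simpa [T] using he
  refine ⟨max 0 (φ e / 2), le_max_left _ _, ?_, e.1, e.2, he'.1, he'.2.1, he'.2.2, ?_⟩
  · rcases le_total (φ e / 2) 0 with h | h
    · exact Or.inl (max_eq_left h)
    · right
      intro i j hi hj hij
      have := hmin (i, j) (by simp [T, hi, hj, hij])
      rw [max_eq_right h]
      simp only [φ] at this ⊢
      linarith
  · have := le_max_right 0 (φ e / 2)
    simp only [φ] at this ⊢
    linarith

section

variable [Fintype N] {d : N → N → ℝ} {S : N × N} {α : ℝ}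

/-- The Gromov product at a point of the small side is at least the isolation index. -/
theorem IsIsolationIndex.two_mul_le_outer (h : IsIsolationIndex d S α) (hN : 4 ≤ Fintype.card N)
    (hd : IsSemimetric d) {s i j : N} (hs : s ∈ side S) (hi : i ∉ side S) (hj : j ∉ side S) :
    2 * α ≤ d s i + d s j - d i j := by
  rcases h.le with h0 | hle
  · have := hd.triangle i s j
    rw [hd.symm i s] at this
    linarith
  have key : ∀ k, k ∉ side S → i ≠ k → 2 * α ≤ d s i + d s k - d i k := by
    intro k hk hik
    have h0 := hle i k hi hk hik
    have e1 := hd.triangle S.2 S.1 k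
    have e2 := hd.triangle S.2 S.1 i
    have e3 := hd.triangle S.1 S.2 k
    have e4 := hd.triangle S.1 S.2 i
    have e5 := hd.symm S.1 S.2
    rcases le_max_iff.1 h0 with h1 | h1 <;> rcases mem_side.1 hs with rfl | rfl <;> linarith
  by_cases hij : i = j
  · subst hij
    obtain ⟨k, hk, hik⟩ := exists_ne_notMem_side hN S i
    have h1 := key k hk hik
    have h2 := hd.triangle s i k
    rw [hd.self]
    linarith
  · exact key j hj hij

/-- The Gromov product at a point of the large side is at least the isolation index. -/
theorem IsIsolationIndex.two_mul_le_inner (h : IsIsolationIndex d S α) (hN : 4 ≤ Fintype.card N)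
    (hd : IsSemimetric d) {s t i : N} (hs : s ∈ side S) (ht : t ∈ side S) (hi : i ∉ side S) :
    2 * α ≤ d s i + d t i - d s t := by
  have self : ∀ s ∈ side S, 2 * α ≤ d s i + d s i - d s s := fun s hs => by
    have := h.two_mul_le_outer hN hd hs hi hi
    rwa [hd.self] at this ⊢
  have key : 2 * α ≤ d S.1 i + d S.2 i - d S.1 S.2 := by
    rcases h.le with h0 | hle
    · have := hd.triangle S.1 i S.2
      rw [hd.symm i] at this
      linarith
    obtain ⟨k, hk, hik⟩ := exists_ne_notMem_side hN S i
    have h0 := hle i k hi hk hik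
    have e1 := hd.triangle S.2 i k
    have e2 := hd.triangle S.1 i k
    rcases le_max_iff.1 h0 with h1 | h1 <;> linarith
  rcases mem_side.1 hs with rfl | rfl <;> rcases mem_side.1 ht with rfl | rfl
  · exact self _ hs
  · exact key
  · rw [hd.symm S.2 S.1]; linarith
  · exact self _ hs

theorem isSemimetric_peel (h : IsIsolationIndex d S α) (hN : 4 ≤ Fintype.card N)
    (hd : IsSemimetric d) : IsSemimetric (peel d S α) where
  nonneg i j := by
    unfold peel
    by_cases hi : i ∈ side S <;> by_cases hj : j ∈ side S
    · rw [cutDist_of_iff (by tauto)]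
      linarith [hd.nonneg i j]
    · rw [cutDist_of_mem_of_notMem hi hj]
      have := h.two_mul_le_outer hN hd hi hj hj
      rw [hd.self] at this
      linarith
    · rw [cutDist_of_notMem_of_mem hi hj]
      have := h.two_mul_le_outer hN hd hj hi hi
      rw [hd.self, hd.symm j i] at this
      linarith
    · rw [cutDist_of_iff (by tauto)]
      linarith [hd.nonneg i j]
  self i := by simp [peel, hd.self, cutDist]
  symm i j := by simp [peel, hd.symm i j, cutDist, iff_comm]
  triangle i j k := by
    have ht := hd.triangle i j k
    unfold peel
    by_cases hi : i ∈ side S <;> by_cases hj : j ∈ side S <;> by_cases hk : k ∈ side S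
    all_goals simp only [cutDist, hi, hj, hk, iff_self, if_true, iff_true, iff_false, not_true,
      if_false]
    all_goals try linarith [h.nonneg]
    · have := h.two_mul_le_inner hN hd hi hk hj
      rw [hd.symm k j] at this
      linarith
    · have := h.two_mul_le_outer hN hd hj hi hk
      rw [hd.symm j i] at this
      linarith

/-- The four-point inequality of the isolation index, with points of either side allowed to
coincide. -/
theorem IsIsolationIndex.le_max (h : IsIsolationIndex d S α) (hN : 4 ≤ Fintype.card N)
    (hd : IsSemimetric d) (hα : α ≠ 0) {s t i j : N} (hs : s ∈ side S) (ht : t ∈ side S)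
    (hi : i ∉ side S) (hj : j ∉ side S) :
    d s t + d i j + 2 * α ≤ max (d s i + d t j) (d s j + d t i) := by
  by_cases hij : i = j
  · subst hij
    have := h.two_mul_le_inner hN hd hs ht hi
    rw [hd.self]
    exact le_max_of_le_left (by linarith)
  have h0 := (h.le.resolve_left hα) i j hi hj hij
  have self : ∀ s ∈ side S, d s s + d i j + 2 * α ≤ max (d s i + d s j) (d s j + d s i) :=
    fun s hs => by
      have := h.two_mul_le_outer hN hd hs hi hj
      rw [hd.self]
      exact le_max_of_le_left (by linarith)
  rcases mem_side.1 hs with rfl | rfl <;> rcases mem_side.1 ht with rfl | rfl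
  · exact self _ hs
  · exact h0
  · rw [hd.symm S.2 S.1, max_comm, add_comm (d S.2 j), add_comm (d S.2 i)]
    exact h0
  · exact self _ hs

theorem MaxPairing.peel (h : IsIsolationIndex d S α) (hN : 4 ≤ Fintype.card N)
    (hd : IsSemimetric d) {p q i j : N} (hm : MaxPairing d p q i j) :
    MaxPairing (peel d S α) p q i j := by
  by_cases hα : α = 0
  · simpa [MaxPairing, ZeroExt.peel, hα] using hm
  have h4 := fun {s t i j} => h.le_max hN hd hα (s := s) (t := t) (i := i) (j := j)
  have h0 := h.nonneg
  have e1 := hd.symm q p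
  have e2 := hd.symm i p
  have e3 := hd.symm j p
  have e4 := hd.symm i q
  have e5 := hd.symm j q
  have e6 := hd.symm i j
  obtain ⟨m1, m2⟩ := hm
  unfold MaxPairing ZeroExt.peel
  by_cases hp : p ∈ side S <;> by_cases hq : q ∈ side S <;> by_cases hi : i ∈ side S <;>
    by_cases hj : j ∈ side S
  all_goals simp only [cutDist, hp, hq, hi, hj, iff_self, if_true, iff_true, iff_false, not_true,
      if_false]
  all_goals try (constructor <;> linarith)
  · rcases le_max_iff.1 (h4 hp hi hq hj) with h | h <;> constructor <;> linarith
  · rcases le_max_iff.1 (h4 hp hj hq hi) with h | h <;> constructor <;> linarith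
  · rcases le_max_iff.1 (h4 hq hi hp hj) with h | h <;> constructor <;> linarith
  · rcases le_max_iff.1 (h4 hq hj hp hi) with h | h <;> constructor <;> linarith

theorem NotStrictMax.peel (h : IsIsolationIndex d S α) (hN : 4 ≤ Fintype.card N)
    (hd : IsSemimetric d) {p q i j : N} (hm : NotStrictMax d p q i j) :
    NotStrictMax (peel d S α) p q i j := by
  by_cases hα : α = 0
  · simpa [NotStrictMax, ZeroExt.peel, hα] using hm
  have h4 := fun {s t i j} => h.le_max hN hd hα (s := s) (t := t) (i := i) (j := j)
  have h0 := h.nonneg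
  have e1 := hd.symm q p
  have e2 := hd.symm i p
  have e3 := hd.symm j p
  have e4 := hd.symm i q
  have e5 := hd.symm j q
  have e6 := hd.symm i j
  unfold NotStrictMax at hm
  rw [le_max_iff] at hm
  unfold NotStrictMax ZeroExt.peel
  rw [le_max_iff]
  by_cases hp : p ∈ side S <;> by_cases hq : q ∈ side S <;> by_cases hi : i ∈ side S <;>
    by_cases hj : j ∈ side S
  all_goals simp only [cutDist, hp, hq, hi, hj, iff_self, if_true, iff_true, iff_false, not_true,
      if_false]
  all_goals try (refine hm.imp ?_ ?_ <;> intro hm <;> linarith)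
  · rcases le_max_iff.1 (h4 hp hq hi hj) with h | h
    · left; linarith
    · right; linarith
  · rcases le_max_iff.1 (h4 hi hj hp hq) with h | h
    · left; linarith
    · right; linarith

end

end Splits

/-! ### Contracting the strip of a split -/

section Strip

variable {N : Type*} {d : N → N → ℝ} {S : N × N} {α : ℝ}

/-- The coordinate of a point `f` of the tight span of `d` across the strip of the split `S`, which
has width `α`: the distance from the far end of the strip. It is `α` on the side of `S` and positive
exactly in front of the far end. -/
noncomputable def depth (d : N → N → ℝ) (S : N × N) (α : ℝ) (f : N → ℝ) : ℝ :=
  max 0 (α - (f S.1 + f S.2 - d S.1 S.2) / 2)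

theorem depth_nonneg (f : N → ℝ) : 0 ≤ depth d S α f := le_max_left _ _

theorem le_depth (f : N → ℝ) : α - (f S.1 + f S.2 - d S.1 S.2) / 2 ≤ depth d S α f :=
  le_max_right _ _

theorem depth_eq_of_pos {f : N → ℝ} (h : 0 < depth d S α f) :
    depth d S α f = α - (f S.1 + f S.2 - d S.1 S.2) / 2 := by
  unfold depth at h ⊢
  rcases le_total (α - (f S.1 + f S.2 - d S.1 S.2) / 2) 0 with h' | h'
  · rw [max_eq_left h'] at h
    exact absurd h (lt_irrefl 0)
  · exact max_eq_right h'

theorem Tight.depth_le {f : N → ℝ} (hf : Tight d f) (hα : 0 ≤ α) : depth d S α f ≤ α :=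
  max_le hα (by linarith [hf.le S.1 S.2])

variable [DecidableEq N]

/-- The point of the tight span of `peel d S α` to which `f` moves when the strip of `S` is
contracted. -/
noncomputable def shrink (d : N → N → ℝ) (S : N × N) (α : ℝ) (f : N → ℝ) (i : N) : ℝ :=
  if i ∈ side S then f i - α + depth d S α f else f i - depth d S α f

theorem shrink_of_mem {f : N → ℝ} {i : N} (hi : i ∈ side S) :
    shrink d S α f i = f i - α + depth d S α f := if_pos hi

theorem shrink_of_notMem {f : N → ℝ} {i : N} (hi : i ∉ side S) :
    shrink d S α f i = f i - depth d S α f := if_neg hi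

/-- A point inside the strip is moved onto a shortest path between the two points of the side. -/
theorem shrink_add_shrink {f : N → ℝ} (h : 0 < depth d S α f) :
    shrink d S α f S.1 + shrink d S α f S.2 = peel d S α S.1 S.2 := by
  rw [shrink_of_mem (left_mem_side S), shrink_of_mem (right_mem_side S), depth_eq_of_pos h, peel,
    cutDist_of_iff (iff_of_true (left_mem_side S) (right_mem_side S))]
  ring

theorem depth_row_of_mem (hα : 0 ≤ α) (hd : IsSemimetric d) {t : N} (ht : t ∈ side S) :
    depth d S α (d t) = α := by
  unfold depth
  rcases mem_side.1 ht with rfl | rfl <;> simp [hd.self, hd.symm S.2 S.1, hα]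

variable [Fintype N]

theorem Tight.two_mul_depth_le (h : IsIsolationIndex d S α) (hN : 4 ≤ Fintype.card N)
    (hd : IsSemimetric d) {f : N → ℝ} (hf : Tight d f) {i j : N} (hi : i ∉ side S)
    (hj : j ∉ side S) : 2 * depth d S α f ≤ f i + f j - d i j := by
  rcases (depth_nonneg f).eq_or_lt with h0 | h0
  · rw [← h0]
    linarith [hf.le i j]
  rw [depth_eq_of_pos h0]
  by_cases hα : α = 0
  · linarith [hf.le i j, hf.le S.1 S.2]
  have e1 := hf.le S.1 i
  have e2 := hf.le S.1 j
  have e3 := hf.le S.2 i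
  have e4 := hf.le S.2 j
  rcases le_max_iff.1 (h.le_max hN hd hα (left_mem_side S) (right_mem_side S) hi hj) with h | h <;>
    linarith

/-- The two inequalities behind the Lipschitz estimate for contracting a strip. -/
theorem Tight.depth_sub_depth_le (h : IsIsolationIndex d S α) (hN : 4 ≤ Fintype.card N)
    (hd : IsSemimetric d) {f g : N → ℝ} (hf : Tight d f) (hg : Tight d g) {M : ℝ}
    (hM : ∀ i, |f i - g i| ≤ M) (hlt : depth d S α g < depth d S α f) (i : N) :
    (i ∈ side S → 2 * (depth d S α f - depth d S α g) ≤ M - (f i - g i)) ∧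
      (i ∉ side S → 2 * (depth d S α f - depth d S α g) ≤ M + (f i - g i)) := by
  have hpos := (depth_nonneg (d := d) (S := S) (α := α) g).trans_lt hlt
  have ef := depth_eq_of_pos hpos
  have eg := le_depth (d := d) (S := S) (α := α) g
  have bound : ∀ s ∈ side S,
      2 * (depth d S α f - depth d S α g) ≤ M - (f s - g s) := by
    have h1 := (abs_le.1 (hM S.1)).1
    have h2 := (abs_le.1 (hM S.2)).1
    intro s hs
    rcases mem_side.1 hs with rfl | rfl <;> linarith
  refine ⟨bound i, fun hi => ?_⟩
  obtain ⟨j, hj⟩ := hg.exists_eq i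
  by_cases hjS : j ∈ side S
  · have h1 := bound j hjS
    have h2 := hf.le i j
    have h1' : 2 * (depth d S α f - depth d S α g) ≤ M - (f j - g j) := h1
    linarith
  · have h1 := hf.two_mul_depth_le h hN hd hi hjS
    have h2 := depth_nonneg (d := d) (S := S) (α := α) g
    have h3 := (abs_le.1 (hM j)).2
    linarith

theorem Tight.shrink_lipschitz (h : IsIsolationIndex d S α) (hN : 4 ≤ Fintype.card N)
    (hd : IsSemimetric d) {f g : N → ℝ} (hf : Tight d f) (hg : Tight d g) {M : ℝ}
    (hM : ∀ i, |f i - g i| ≤ M) (i : N) :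
    |shrink d S α f i - shrink d S α g i| ≤ M - |depth d S α f - depth d S α g| := by
  wlog hlt : depth d S α g ≤ depth d S α f generalizing f g
  · rw [abs_sub_comm, abs_sub_comm (depth d S α f)]
    exact this hg hf (fun i => by rw [abs_sub_comm]; exact hM i) (le_of_not_ge hlt)
  have hi := abs_le.1 (hM i)
  rw [abs_of_nonneg (sub_nonneg.2 hlt), abs_le]
  rcases hlt.eq_or_lt with heq | hlt
  · by_cases hiS : i ∈ side S
    · rw [shrink_of_mem hiS, shrink_of_mem hiS]
      constructor <;> linarith
    · rw [shrink_of_notMem hiS, shrink_of_notMem hiS]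
      constructor <;> linarith
  · obtain ⟨h1, h2⟩ := hf.depth_sub_depth_le h hN hd hg hM hlt i
    by_cases hiS : i ∈ side S
    · have := h1 hiS
      rw [shrink_of_mem hiS, shrink_of_mem hiS]
      constructor <;> linarith
    · have := h2 hiS
      rw [shrink_of_notMem hiS, shrink_of_notMem hiS]
      constructor <;> linarith

theorem Tight.shrink (h : IsIsolationIndex d S α) (hN : 4 ≤ Fintype.card N)
    (hd : IsSemimetric d) {f : N → ℝ} (hf : Tight d f) :
    Tight (peel d S α) (shrink d S α f) := by
  have hα := h.nonneg
  have hle := le_depth (d := d) (S := S) (α := α) f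
  have h0 := depth_nonneg (d := d) (S := S) (α := α) f
  have hmax := hf.depth_le (S := S) hα
  have hout := fun {i j} => hf.two_mul_depth_le h hN hd (i := i) (j := j)
  have e := hd.symm S.1 S.2
  have l1 := hf.le_add hd S.1 S.2
  have l2 := hf.le_add hd S.2 S.1
  have hp := left_mem_side S
  have hq := right_mem_side S
  constructor
  · intro i j
    have hij := hf.le i j
    by_cases hi : i ∈ side S <;> by_cases hj : j ∈ side S
    · rw [shrink_of_mem hi, shrink_of_mem hj, peel, cutDist_of_iff (iff_of_true hi hj)]
      rcases mem_side.1 hi with rfl | rfl <;> rcases mem_side.1 hj with rfl | rfl <;>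
        linarith [hd.self S.1, hd.self S.2]
    · rw [shrink_of_mem hi, shrink_of_notMem hj, peel, cutDist_of_mem_of_notMem hi hj]
      linarith
    · rw [shrink_of_notMem hi, shrink_of_mem hj, peel, cutDist_of_notMem_of_mem hi hj]
      linarith
    · rw [shrink_of_notMem hi, shrink_of_notMem hj, peel, cutDist_of_iff (iff_of_false hi hj)]
      linarith [hout hi hj]
  · intro i
    obtain ⟨j, hj⟩ := hf.exists_eq i
    refine ⟨j, ?_⟩
    by_cases hi : i ∈ side S <;> by_cases hjS : j ∈ side S
    · -- a pair inside the side is tight only at the near end of the strip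
      have : depth d S α f = α := by
        rcases mem_side.1 hi with rfl | rfl <;> rcases mem_side.1 hjS with rfl | rfl <;>
          linarith [hd.self S.1, hd.self S.2]
      rw [shrink_of_mem hi, shrink_of_mem hjS, peel, cutDist_of_iff (iff_of_true hi hjS)]
      linarith
    · rw [shrink_of_mem hi, shrink_of_notMem hjS, peel, cutDist_of_mem_of_notMem hi hjS]
      linarith
    · rw [shrink_of_notMem hi, shrink_of_mem hjS, peel, cutDist_of_notMem_of_mem hi hjS]
      linarith
    · -- a pair outside the side is tight only beyond the far end of the strip
      have := hout hi hjS
      rw [shrink_of_notMem hi, shrink_of_notMem hjS, peel, cutDist_of_iff (iff_of_false hi hjS)]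
      linarith

theorem depth_row_of_notMem (h : IsIsolationIndex d S α) (hN : 4 ≤ Fintype.card N)
    (hd : IsSemimetric d) {t : N} (ht : t ∉ side S) : depth d S α (d t) = 0 := by
  have := h.two_mul_le_inner hN hd (left_mem_side S) (right_mem_side S) ht
  rw [hd.symm _ t, hd.symm _ t] at this
  exact max_eq_left (by linarith)

theorem shrink_row (h : IsIsolationIndex d S α) (hN : 4 ≤ Fintype.card N)
    (hd : IsSemimetric d) (t : N) : ZeroExt.shrink d S α (d t) = peel d S α t := by
  ext i
  by_cases ht : t ∈ side S
  · have hdep := depth_row_of_mem h.nonneg hd ht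
    by_cases hi : i ∈ side S
    · rw [shrink_of_mem hi, hdep, peel, cutDist_of_iff (iff_of_true ht hi)]
      ring
    · rw [shrink_of_notMem hi, hdep, peel, cutDist_of_mem_of_notMem ht hi]
      ring
  · have hdep := depth_row_of_notMem h hN hd ht
    by_cases hi : i ∈ side S
    · rw [shrink_of_mem hi, hdep, peel, cutDist_of_notMem_of_mem ht hi]
      ring
    · rw [shrink_of_notMem hi, hdep, peel, cutDist_of_iff (iff_of_false ht hi)]
      ring

end Strip

/-! ### Decomposition along a list of splits -/

section Decomposition

variable {N : Type*} [DecidableEq N]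

/-- The result of splitting off the splits of the list `L` from the semimetric `d` one after the
other: weights `w` and a remainder `rest` with `d = rest + ∑ w S * cutDist S`, and, on the tight
span of `d`, one coordinate `coord S` for each split and a map `proj` to the tight span of `rest`.
The properties of the remainder that reflect the vanishing of isolation indices are recorded by the
maximal pairings, as these persist when further splits are split off. -/
structure SplitDecomposition (d : N → N → ℝ) (L : List (N × N)) where
  w : N × N → ℝ
  rest : N → N → ℝ
  coord : N × N → (N → ℝ) → ℝ
  proj : (N → ℝ) → N → ℝ
  w_nonneg : ∀ S ∈ L, 0 ≤ w S
  isSemimetric_rest : IsSemimetric rest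
  eq_add_sum : ∀ i j, d i j = rest i j + ∑ S ∈ L.toFinset, w S * cutDist S i j
  tight_proj : ∀ {f}, Tight d f → Tight rest (proj f)
  coord_nonneg : ∀ S ∈ L, ∀ {f}, Tight d f → 0 ≤ coord S f
  coord_le : ∀ S ∈ L, ∀ {f}, Tight d f → coord S f ≤ w S
  lipschitz : ∀ {f g}, Tight d f → Tight d g → ∀ {M}, (∀ i, |f i - g i| ≤ M) →
    ∀ i, |proj f i - proj g i| + ∑ S ∈ L.toFinset, |coord S f - coord S g| ≤ M
  coord_row_of_mem : ∀ S ∈ L, ∀ {t}, t ∈ side S → coord S (d t) = w S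
  coord_row_of_notMem : ∀ S ∈ L, ∀ {t}, t ∉ side S → coord S (d t) = 0
  proj_row : ∀ t, proj (d t) = rest t
  /-- A point inside the strip of a split lies, in the tight span of the remainder, on a shortest
  path between the two points of the side. -/
  proj_add_proj : ∀ S ∈ L, ∀ {f}, Tight d f → 0 < coord S f →
    proj f S.1 + proj f S.2 = rest S.1 S.2
  /-- A point inside the strip of a split has the same coordinates as the points of the side with
  respect to all later splits that do not separate these. -/
  pairwise : L.Pairwise fun S S' => ∀ f, Tight d f → 0 < coord S f →
    (S.1 ∈ side S' ↔ S.2 ∈ side S') → coord S' f = coord S' (d S.1)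
  maxPairing : ∀ {p q i j}, MaxPairing d p q i j → MaxPairing rest p q i j
  notStrictMax : ∀ {p q i j}, NotStrictMax d p q i j → NotStrictMax rest p q i j
  exists_maxPairing : ∀ S ∈ L, ∃ i j, i ∉ side S ∧ j ∉ side S ∧ i ≠ j ∧
    MaxPairing rest S.1 S.2 i j
  of_pos : ∀ S ∈ L, 0 < w S → ∀ i j, i ∉ side S → j ∉ side S → i ≠ j →
    ¬MaxPairing d S.1 S.2 i j ∧ NotStrictMax rest S.1 S.2 i j

variable {d : N → N → ℝ} {L : List (N × N)}

theorem SplitDecomposition.coord_row_eq_of_iff (D : SplitDecomposition d L) {S : N × N} (hS : S ∈ L)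
    {p q : N} (h : p ∈ side S ↔ q ∈ side S) : D.coord S (d p) = D.coord S (d q) := by
  by_cases hp : p ∈ side S
  · rw [D.coord_row_of_mem S hS hp, D.coord_row_of_mem S hS (h.1 hp)]
  · rw [D.coord_row_of_notMem S hS hp, D.coord_row_of_notMem S hS (fun hq => hp (h.2 hq))]

theorem SplitDecomposition.abs_coord_row_sub (D : SplitDecomposition d L) {S : N × N} (hS : S ∈ L)
    (p q : N) : |D.coord S (d p) - D.coord S (d q)| = D.w S * cutDist S p q := by
  have hw := D.w_nonneg S hS
  by_cases hp : p ∈ side S <;> by_cases hq : q ∈ side S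
  · rw [D.coord_row_eq_of_iff hS (iff_of_true hp hq), cutDist_of_iff (iff_of_true hp hq)]
    simp
  · rw [D.coord_row_of_mem S hS hp, D.coord_row_of_notMem S hS hq, cutDist_of_mem_of_notMem hp hq]
    simp [abs_of_nonneg hw]
  · rw [D.coord_row_of_notMem S hS hp, D.coord_row_of_mem S hS hq, cutDist_of_notMem_of_mem hp hq]
    simp [abs_of_nonneg hw]
  · rw [D.coord_row_eq_of_iff hS (iff_of_false hp hq), cutDist_of_iff (iff_of_false hp hq)]
    simp

theorem Tight.abs_sub_row_le {N : Type*} {d : N → N → ℝ} (hd : IsSemimetric d) {f : N → ℝ}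
    (hf : Tight d f) (t i : N) : |f i - d t i| ≤ f t := by
  have h1 := hf.le t i
  have h2 := hf.le_add hd i t
  rw [hd.symm i t] at h2
  rw [abs_le]
  constructor <;> linarith

/-- On a shortest path between `p` and `q` all the estimates of the decomposition are equalities. -/
theorem SplitDecomposition.of_add_eq (D : SplitDecomposition d L) (hd : IsSemimetric d)
    {f : N → ℝ} (hf : Tight d f) {p q : N} (hpq : f p + f q = d p q) :
    D.proj f p + D.proj f q = D.rest p q ∧
      ∀ S ∈ L, (p ∈ side S ↔ q ∈ side S) → D.coord S f = D.coord S (d p) := by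
  have hp := D.lipschitz hf (tight_row hd p) (hf.abs_sub_row_le hd p) p
  have hq := D.lipschitz hf (tight_row hd q) (hf.abs_sub_row_le hd q) q
  rw [D.proj_row, D.isSemimetric_rest.self, sub_zero] at hp hq
  have hp' := le_abs_self (D.proj f p)
  have hq' := le_abs_self (D.proj f q)
  have hle := (D.tight_proj hf).le p q
  have hsum := D.eq_add_sum p q
  have hterm : ∀ S ∈ L.toFinset, 0 ≤ |D.coord S f - D.coord S (d p)| +
      |D.coord S f - D.coord S (d q)| - D.w S * cutDist S p q := by
    intro S hS
    rw [← D.abs_coord_row_sub (List.mem_toFinset.1 hS)]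
    have := abs_sub_le (D.coord S (d p)) (D.coord S f) (D.coord S (d q))
    rw [abs_sub_comm (D.coord S (d p)) (D.coord S f)] at this
    linarith
  have htot : ∑ S ∈ L.toFinset, (|D.coord S f - D.coord S (d p)| +
      |D.coord S f - D.coord S (d q)| - D.w S * cutDist S p q) =
      ∑ S ∈ L.toFinset, |D.coord S f - D.coord S (d p)| +
      ∑ S ∈ L.toFinset, |D.coord S f - D.coord S (d q)| -
      ∑ S ∈ L.toFinset, D.w S * cutDist S p q := by
    rw [sum_sub_distrib, sum_add_distrib]
  have hnn := sum_nonneg hterm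
  refine ⟨by linarith, fun S hS hiff => ?_⟩
  have h0 := (sum_eq_zero_iff_of_nonneg hterm).1 (by linarith) S (List.mem_toFinset.2 hS)
  rw [cutDist_of_iff hiff, ← D.coord_row_eq_of_iff hS hiff] at h0
  have := abs_nonneg (D.coord S f - D.coord S (d p))
  exact sub_eq_zero.1 (abs_eq_zero.1 (by linarith))

/-- The decomposition along the empty list. -/
def SplitDecomposition.nil (hd : IsSemimetric d) : SplitDecomposition d [] where
  w _ := 0
  rest := d
  coord _ _ := 0
  proj := id
  w_nonneg _ _ := le_rfl
  isSemimetric_rest := hd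
  eq_add_sum _ _ := by simp
  tight_proj := id
  coord_nonneg _ _ _ _ := le_rfl
  coord_le _ _ _ _ := le_rfl
  lipschitz _ _ _ h i := by simpa using h i
  coord_row_of_mem _ _ _ _ := rfl
  coord_row_of_notMem _ _ _ _ := rfl
  proj_row _ := rfl
  proj_add_proj _ h := by simp at h
  pairwise := List.Pairwise.nil
  maxPairing := id
  notStrictMax := id
  exists_maxPairing _ h := by simp at h
  of_pos _ h := by simp at h

/-- Splitting off `S` first and then decomposing the remaining semimetric. -/
noncomputable def SplitDecomposition.cons [Fintype N] (hN : 4 ≤ Fintype.card N)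
    (hd : IsSemimetric d) {S : N × N} (hS : S ∉ L) {α : ℝ} (hα : IsIsolationIndex d S α)
    (D : SplitDecomposition (peel d S α) L) : SplitDecomposition d (S :: L) :=
  have hne : ∀ {S'}, S' ∈ L → S' ≠ S := fun h e => hS (e ▸ h)
  have sum_cons : ∀ (F G : N × N → ℝ), (∀ S' ∈ L, F S' = G S') →
      ∑ S' ∈ (S :: L).toFinset, F S' = F S + ∑ S' ∈ L.toFinset, G S' := by
    intro F G h
    rw [List.toFinset_cons, sum_insert (by simpa using hS)]
    congr 1
    exact sum_congr rfl fun S' hS' => h S' (List.mem_toFinset.1 hS')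
  have hd' := isSemimetric_peel hα hN hd
  { w := Function.update D.w S α
    rest := D.rest
    coord := Function.update (fun S' f => D.coord S' (shrink d S α f)) S (depth d S α)
    proj := fun f => D.proj (shrink d S α f)
    w_nonneg := by
      intro S' hS'
      rcases List.mem_cons.1 hS' with rfl | h
      · simpa using hα.nonneg
      · simpa [hne h] using D.w_nonneg S' h
    isSemimetric_rest := D.isSemimetric_rest
    eq_add_sum := by
      intro i j
      rw [sum_cons _ (fun S' => D.w S' * cutDist S' i j) (fun S' h => by simp [hne h])]
      have := D.eq_add_sum i j
      simp only [Function.update_self]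
      unfold peel at this
      linarith
    tight_proj := fun hf => D.tight_proj (hf.shrink hα hN hd)
    coord_nonneg := by
      intro S' hS' f hf
      rcases List.mem_cons.1 hS' with rfl | h
      · simpa using depth_nonneg f
      · simpa [hne h] using D.coord_nonneg S' h (hf.shrink hα hN hd)
    coord_le := by
      intro S' hS' f hf
      rcases List.mem_cons.1 hS' with rfl | h
      · simpa using hf.depth_le hα.nonneg
      · simpa [hne h] using D.coord_le S' h (hf.shrink hα hN hd)
    lipschitz := by
      intro f g hf hg M hM i
      rw [sum_cons _ (fun S' => |D.coord S' (shrink d S α f) - D.coord S' (shrink d S α g)|)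
        (fun S' h => by simp [hne h])]
      have := D.lipschitz (hf.shrink hα hN hd) (hg.shrink hα hN hd)
        (hf.shrink_lipschitz hα hN hd hg hM) i
      simp only [Function.update_self]
      linarith
    coord_row_of_mem := by
      intro S' hS' t ht
      rcases List.mem_cons.1 hS' with rfl | h
      · simpa using depth_row_of_mem hα.nonneg hd ht
      · simpa [hne h, shrink_row hα hN hd] using D.coord_row_of_mem S' h ht
    coord_row_of_notMem := by
      intro S' hS' t ht
      rcases List.mem_cons.1 hS' with rfl | h
      · simpa using depth_row_of_notMem hα hN hd ht
      · simpa [hne h, shrink_row hα hN hd] using D.coord_row_of_notMem S' h ht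
    proj_row := fun t => by rw [shrink_row hα hN hd, D.proj_row]
    proj_add_proj := by
      intro S' hS' f hf hpos
      rcases List.mem_cons.1 hS' with rfl | h
      · rw [Function.update_self] at hpos
        exact (D.of_add_eq hd' (hf.shrink hα hN hd) (shrink_add_shrink hpos)).1
      · rw [Function.update_of_ne (hne h)] at hpos
        exact D.proj_add_proj S' h (hf.shrink hα hN hd) hpos
    pairwise := by
      rw [List.pairwise_cons]
      constructor
      · intro S' h f hf hpos hiff
        rw [Function.update_self] at hpos
        rw [Function.update_of_ne (hne h), shrink_row hα hN hd]
        exact (D.of_add_eq hd' (hf.shrink hα hN hd) (shrink_add_shrink hpos)).2 S' h hiff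
      · refine D.pairwise.imp_of_mem fun {S₁ S₂} h₁ h₂ H f hf => ?_
        rw [Function.update_of_ne (hne h₁), Function.update_of_ne (hne h₂), shrink_row hα hN hd]
        exact H _ (hf.shrink hα hN hd)
    maxPairing := fun h => D.maxPairing (h.peel hα hN hd)
    notStrictMax := fun h => D.notStrictMax (h.peel hα hN hd)
    exists_maxPairing := by
      intro S' hS'
      rcases List.mem_cons.1 hS' with rfl | h
      · obtain ⟨i, j, hi, hj, hij, hle⟩ := hα.attained
        have hp := left_mem_side S'
        have hq := right_mem_side S'
        refine ⟨i, j, hi, hj, hij, D.maxPairing ?_⟩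
        have h1 := (le_max_left _ _).trans hle
        have h2 := (le_max_right _ _).trans hle
        unfold MaxPairing peel
        rw [cutDist_of_mem_of_notMem hp hi, cutDist_of_mem_of_notMem hq hj,
          cutDist_of_mem_of_notMem hp hj, cutDist_of_mem_of_notMem hq hi,
          cutDist_of_iff (iff_of_true hp hq), cutDist_of_iff (iff_of_false hi hj)]
        constructor <;> linarith
      · exact D.exists_maxPairing S' h
    of_pos := by
      intro S' hS' hpos i j hi hj hij
      rcases List.mem_cons.1 hS' with rfl | h
      · rw [Function.update_self] at hpos
        have hle := hα.le.resolve_left hpos.ne' i j hi hj hij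
        have hp := left_mem_side S'
        have hq := right_mem_side S'
        refine ⟨fun hm => ?_, D.notStrictMax ?_⟩
        · have := hle.trans (max_le hm.1 hm.2)
          linarith
        · unfold NotStrictMax peel
          rw [cutDist_of_mem_of_notMem hp hi, cutDist_of_mem_of_notMem hq hj,
            cutDist_of_mem_of_notMem hp hj, cutDist_of_mem_of_notMem hq hi,
            cutDist_of_iff (iff_of_true hp hq), cutDist_of_iff (iff_of_false hi hj)]
          rcases le_max_iff.1 hle with h | h
          · exact le_max_of_le_left (by linarith)
          · exact le_max_of_le_right (by linarith)
      · rw [Function.update_of_ne (hne h)] at hpos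
        obtain ⟨h1, h2⟩ := D.of_pos S' h hpos i j hi hj hij
        exact ⟨fun hm => h1 (hm.peel hα hN hd), h2⟩ }

theorem nonempty_splitDecomposition [Fintype N] (hN : 4 ≤ Fintype.card N) {L : List (N × N)}
    (hL : L.Nodup) : ∀ {d : N → N → ℝ}, IsSemimetric d → Nonempty (SplitDecomposition d L) := by
  induction L with
  | nil => exact fun hd => ⟨.nil hd⟩
  | cons S L ih =>
    intro d hd
    obtain ⟨α, hα⟩ := exists_isIsolationIndex hN d S
    obtain ⟨D⟩ := ih (List.nodup_cons.1 hL).2 (isSemimetric_peel hα hN hd)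
    exact ⟨.cons hN hd (List.nodup_cons.1 hL).1 hα D⟩

end Decomposition

/-! ### Prime semimetrics on five points -/

section Prime

variable {N : Type*}

/-- `d` is `m` times the path metric of the complete bipartite graph `K_{2,3}` whose class of two
vertices is `{a, b}`. For `m = 0` this says that `d` vanishes. -/
structure IsK23 (d : N → N → ℝ) (a b : N) (m : ℝ) : Prop where
  nonneg : 0 ≤ m
  ne : a ≠ b
  left_right : d a b = 2 * m
  left : ∀ i, i ≠ a → i ≠ b → d a i = m
  right : ∀ i, i ≠ a → i ≠ b → d b i = m
  other : ∀ i j, i ≠ a → i ≠ b → j ≠ a → j ≠ b → i ≠ j → d i j = 2 * m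

/-- The semimetrics all of whose isolation indices vanish. -/
structure IsPrime (d : N → N → ℝ) : Prop where
  pair : ∀ p q, p ≠ q → ∃ i j, i ≠ p ∧ i ≠ q ∧ j ≠ p ∧ j ≠ q ∧ i ≠ j ∧ MaxPairing d p q i j
  single : ∀ p, ∃ i j, i ≠ p ∧ j ≠ p ∧ i ≠ j ∧ d p i + d p j ≤ d i j

/-- The five points `a`, `b`, `x`, `y`, `z` are distinct and there are no others. -/
def Enumerates (a b x y z : N) : Prop :=
  [a, b, x, y, z].Nodup ∧ ∀ i, i = a ∨ i = b ∨ i = x ∨ i = y ∨ i = z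

theorem Enumerates.perm {a b x y z a' b' x' y' z' : N} (h : Enumerates a b x y z)
    (hp : [a', b', x', y', z'].Perm [a, b, x, y, z] := by
      classical
      simp only [List.perm_iff_count, List.count_cons, List.count_nil]
      intro
      ring) : Enumerates a' b' x' y' z' := by
  refine ⟨hp.nodup_iff.2 h.1, fun i => ?_⟩
  have := hp.mem_iff (a := i)
  simp only [List.mem_cons, List.not_mem_nil, or_false] at this
  exact this.2 (h.2 i)

theorem MaxPairing.swap_right {d : N → N → ℝ} (hd : IsSemimetric d) {p q i j : N}
    (h : MaxPairing d p q i j) : MaxPairing d p q j i :=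
  ⟨by rw [hd.symm j i]; exact h.2, by rw [hd.symm j i]; exact h.1⟩

theorem IsPrime.pair_cases {d : N → N → ℝ} (hp : IsPrime d) (hd : IsSemimetric d) {a b x y z : N}
    (h : Enumerates a b x y z) :
    MaxPairing d a b x y ∨ MaxPairing d a b x z ∨ MaxPairing d a b y z := by
  have hn := h.1
  simp only [List.nodup_cons, List.mem_cons, List.not_mem_nil, or_false, not_or] at hn
  obtain ⟨i, j, hia, hib, hja, hjb, hij, hm⟩ := hp.pair a b (by tauto)
  have hm' := hm.swap_right hd
  rcases h.2 i with rfl | rfl | rfl | rfl | rfl <;>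
    rcases h.2 j with rfl | rfl | rfl | rfl | rfl <;> tauto

theorem IsPrime.single_cases {d : N → N → ℝ} (hp : IsPrime d) (hd : IsSemimetric d) {a b x y z : N}
    (h : Enumerates a b x y z) :
    d a b + d a x ≤ d b x ∨ d a b + d a y ≤ d b y ∨ d a b + d a z ≤ d b z ∨
      d a x + d a y ≤ d x y ∨ d a x + d a z ≤ d x z ∨ d a y + d a z ≤ d y z := by
  obtain ⟨i, j, hia, hja, hij, hm⟩ := hp.single a
  have hm' := hm
  rw [add_comm, hd.symm i j] at hm'
  rcases h.2 i with rfl | rfl | rfl | rfl | rfl <;>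
    rcases h.2 j with rfl | rfl | rfl | rfl | rfl <;> tauto

theorem Enumerates.isK23 {d : N → N → ℝ} (hd : IsSemimetric d) {a b x y z : N} {m : ℝ}
    (h : Enumerates a b x y z) (hm : 0 ≤ m) (hab : d a b = 2 * m)
    (hax : d a x = m) (hay : d a y = m) (haz : d a z = m)
    (hbx : d b x = m) (hby : d b y = m) (hbz : d b z = m)
    (hxy : d x y = 2 * m) (hxz : d x z = 2 * m) (hyz : d y z = 2 * m) : IsK23 d a b m where
  nonneg := hm
  ne := by
    have hn := h.1
    simp only [List.nodup_cons, List.mem_cons, List.not_mem_nil, or_false, not_or] at hn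
    tauto
  left_right := hab
  left i hia hib := by rcases h.2 i with rfl | rfl | rfl | rfl | rfl <;> first | assumption | tauto
  right i hia hib := by rcases h.2 i with rfl | rfl | rfl | rfl | rfl <;> first | assumption | tauto
  other i j hia hib hja hjb hij := by
    have hyx := hd.symm y x
    have hzx := hd.symm z x
    have hzy := hd.symm z y
    rcases h.2 i with rfl | rfl | rfl | rfl | rfl <;>
      rcases h.2 j with rfl | rfl | rfl | rfl | rfl <;> first | linarith | tauto

/-- A prime semimetric that identifies two points vanishes. -/
theorem IsPrime.eq_zero_of_dist_eq_zero {d : N → N → ℝ} (hp : IsPrime d) (hd : IsSemimetric d)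
    {a b x y z : N} (h : Enumerates a b x y z) (hab : d a b = 0) : IsK23 d a b 0 := by
  have tr : ∀ i, d b i = d a i := fun i => by
    have h1 := hd.triangle a b i
    have h2 := hd.triangle b a i
    rw [hd.symm b a] at h2
    linarith
  have n1 := hd.nonneg a x
  have n2 := hd.nonneg a y
  have n3 := hd.nonneg a z
  have t1 := tr x
  have t2 := tr y
  have t3 := tr z
  have s1 := hd.symm y x
  have s2 := hd.symm z x
  have s3 := hd.symm z y
  have s4 := hd.symm x a
  have s5 := hd.symm y a
  have s6 := hd.symm z a
  have s7 := hd.symm x b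
  have s8 := hd.symm y b
  have s9 := hd.symm z b
  have u1 := hd.triangle x a y
  have u2 := hd.triangle x a z
  have u3 := hd.triangle y a z
  -- a pair is a maximal pairing with another one only if `a` lies between its points
  have between : d a x + d a y ≤ d x y ∧ d a x + d a z ≤ d x z ∧ d a y + d a z ≤ d y z := by
    have q0 := hp.pair_cases hd h
    have q1 := hp.pair_cases hd (h.perm (a' := x) (b' := y) (x' := a) (y' := b) (z' := z))
    have q2 := hp.pair_cases hd (h.perm (a' := x) (b' := z) (x' := a) (y' := b) (z' := y))
    have q3 := hp.pair_cases hd (h.perm (a' := y) (b' := z) (x' := a) (y' := b) (z' := x))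
    unfold MaxPairing at q0 q1 q2 q3
    rcases q0 with q0 | q0 | q0
    · refine ⟨by linarith, ?_, ?_⟩
      · rcases q2 with q | q | q <;> linarith
      · rcases q3 with q | q | q <;> linarith
    · refine ⟨?_, by linarith, ?_⟩
      · rcases q1 with q | q | q <;> linarith
      · rcases q3 with q | q | q <;> linarith
    · refine ⟨?_, ?_, by linarith⟩
      · rcases q1 with q | q | q <;> linarith
      · rcases q2 with q | q | q <;> linarith
  obtain ⟨b1, b2, b3⟩ := between
  have z1 : d a x = 0 := by
    rcases hp.single_cases hd (h.perm (a' := x) (b' := a) (x' := b) (y' := y) (z' := z)) with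
      q | q | q | q | q | q <;> linarith
  have z2 : d a y = 0 := by
    rcases hp.single_cases hd (h.perm (a' := y) (b' := a) (x' := b) (y' := x) (z' := z)) with
      q | q | q | q | q | q <;> linarith
  have z3 : d a z = 0 := by
    rcases hp.single_cases hd (h.perm (a' := z) (b' := a) (x' := b) (y' := x) (z' := y)) with
      q | q | q | q | q | q <;> linarith
  have m1 := hd.nonneg x y
  have m2 := hd.nonneg x z
  have m3 := hd.nonneg y z
  apply h.isK23 hd <;> linarith

/-- The case of two points `a`, `b` at maximal distance that lie between the same two points. The
four points then form a rectangle, and the last point is the third vertex of one of the classes. -/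
theorem IsPrime.isK23_of_between {d : N → N → ℝ} (hp : IsPrime d) (hd : IsSemimetric d)
    {a b x y z : N} (h : Enumerates a b x y z) (hpos : ∀ i j, i ≠ j → 0 < d i j)
    (hmax : ∀ i j, d i j ≤ d a b) (ha : d a x + d a y ≤ d x y) (hb : d b x + d b y ≤ d x y) :
    ∃ a' b' m, IsK23 d a' b' m := by
  have hn := h.1
  simp only [List.nodup_cons, List.mem_cons, List.not_mem_nil, or_false, not_or] at hn
  have s0 := hd.symm b a
  have s1 := hd.symm y x
  have s2 := hd.symm z x
  have s3 := hd.symm z y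
  have s4 := hd.symm x a
  have s5 := hd.symm y a
  have s6 := hd.symm z a
  have s7 := hd.symm x b
  have s8 := hd.symm y b
  have s9 := hd.symm z b
  have m1 := hmax x y
  have t1 := hd.triangle a x b
  have t2 := hd.triangle a y b
  have p1 := hpos a x (by tauto)
  have p2 := hpos a y (by tauto)
  have p3 := hpos a z (by tauto)
  have p4 := hpos b z (by tauto)
  have p5 := hpos x z (by tauto)
  have p6 := hpos y z (by tauto)
  -- the sides of the rectangle
  obtain ⟨e1, e2, e3, e4⟩ : d x y = d a b ∧ d b y = d a x ∧ d b x = d a y ∧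
      d a x + d a y = d a b := by
    refine ⟨?_, ?_, ?_, ?_⟩ <;> linarith
  have m2 := hmax a z
  have m3 := hmax b z
  have m4 := hmax x z
  have m5 := hmax y z
  have side_ax : d b z = d a y + d x z ∨ d y z = d a y + d a z := by
    have t := hd.triangle b x z
    have t' := hd.triangle y a z
    have q := hp.pair_cases hd (h.perm (a' := a) (b' := x) (x' := b) (y' := y) (z' := z))
    unfold MaxPairing at q
    rcases q with q | q | q
    · linarith
    · left; linarith
    · right; linarith
  have side_by : d a z = d a y + d y z ∨ d x z = d a y + d b z := by
    have t := hd.triangle a y z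
    have t' := hd.triangle x b z
    have q := hp.pair_cases hd (h.perm (a' := b) (b' := y) (x' := a) (y' := x) (z' := z))
    unfold MaxPairing at q
    rcases q with q | q | q
    · linarith
    · left; linarith
    · right; linarith
  have side_ay : d b z = d a x + d y z ∨ d x z = d a x + d a z := by
    have t := hd.triangle b y z
    have t' := hd.triangle x a z
    have q := hp.pair_cases hd (h.perm (a' := a) (b' := y) (x' := b) (y' := x) (z' := z))
    unfold MaxPairing at q
    rcases q with q | q | q
    · linarith
    · left; linarith
    · right; linarith
  have side_bx : d a z = d a x + d x z ∨ d y z = d a x + d b z := by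
    have t := hd.triangle a x z
    have t' := hd.triangle y b z
    have q := hp.pair_cases hd (h.perm (a' := b) (b' := x) (x' := a) (y' := y) (z' := z))
    unfold MaxPairing at q
    rcases q with q | q | q
    · linarith
    · left; linarith
    · right; linarith
  have hz := hp.single_cases hd (h.perm (a' := z) (b' := a) (x' := b) (y' := x) (z' := y))
  have : (d b z = d a y + d x z ∧ d a z = d a y + d y z ∧ d b z = d a x + d y z ∧
        d a z = d a x + d x z) ∨
      (d y z = d a y + d a z ∧ d x z = d a y + d b z ∧ d x z = d a x + d a z ∧
        d y z = d a x + d b z) := by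
    rcases side_ax with q1 | q1 <;> rcases side_by with q2 | q2 <;>
      rcases side_ay with q3 | q3 <;> rcases side_bx with q4 | q4 <;>
      first
      | exact Or.inl ⟨q1, q2, q3, q4⟩
      | exact Or.inr ⟨q1, q2, q3, q4⟩
      | linarith
  rcases this with ⟨q1, q2, q3, q4⟩ | ⟨q1, q2, q3, q4⟩
  · have t := hd.triangle x z y
    have : d x z = d a x := by
      rcases hz with q | q | q | q | q | q <;> linarith
    refine ⟨x, y, d a x, (h.perm (a' := x) (b' := y) (x' := a) (y' := b) (z' := z)).isK23 hd
      ?_ ?_ ?_ ?_ ?_ ?_ ?_ ?_ ?_ ?_ ?_⟩ <;> linarith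
  · have t := hd.triangle a z b
    have : d a z = d a x := by
      rcases hz with q | q | q | q | q | q <;> linarith
    refine ⟨a, b, d a x, h.isK23 hd ?_ ?_ ?_ ?_ ?_ ?_ ?_ ?_ ?_ ?_ ?_⟩ <;> linarith

/-- If two points `a`, `b` at maximal distance lie between pairs with one common point, then they
also lie between the remaining two points of these pairs. -/
theorem IsPrime.isK23_of_between_of_between {d : N → N → ℝ} (hp : IsPrime d) (hd : IsSemimetric d)
    {a b x y z : N} (h : Enumerates a b x y z) (hpos : ∀ i j, i ≠ j → 0 < d i j)
    (hmax : ∀ i j, d i j ≤ d a b) (ha : d a x + d a y ≤ d x y) (hb : d b x + d b z ≤ d x z) :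
    ∃ a' b' m, IsK23 d a' b' m := by
  have hn := h.1
  simp only [List.nodup_cons, List.mem_cons, List.not_mem_nil, or_false, not_or] at hn
  have s0 := hd.symm b a
  have s1 := hd.symm y x
  have s2 := hd.symm z x
  have s3 := hd.symm z y
  have s4 := hd.symm x a
  have s5 := hd.symm y a
  have s6 := hd.symm z a
  have s7 := hd.symm x b
  have s8 := hd.symm y b
  have s9 := hd.symm z b
  have p1 := hpos a y (by tauto)
  have p2 := hpos b z (by tauto)
  have p3 := hpos b x (by tauto)
  have p4 := hpos a x (by tauto)
  have m1 := hmax b y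
  have m2 := hmax b z
  have m3 := hmax a y
  have m4 := hmax a z
  have m5 := hmax a x
  have m6 := hmax b x
  have ha' : d a y + d a z ≤ d y z := by
    have q := hp.pair_cases hd (h.perm (a' := a) (b' := x) (x' := b) (y' := y) (z' := z))
    unfold MaxPairing at q
    rcases q with q | q | q <;> linarith
  have hb' : d b y + d b z ≤ d y z := by
    have q := hp.pair_cases hd (h.perm (a' := b) (b' := x) (x' := a) (y' := y) (z' := z))
    unfold MaxPairing at q
    rcases q with q | q | q <;> linarith
  exact hp.isK23_of_between hd (h.perm (a' := a) (b' := b) (x' := y) (y' := z) (z' := x)) hpos hmax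
    ha' hb'

/-- The only prime semimetrics on five points are the multiples of the metric of `K_{2,3}`. -/
theorem IsPrime.exists_isK23 {d : Fin 5 → Fin 5 → ℝ} (hp : IsPrime d) (hd : IsSemimetric d) :
    ∃ a b m, IsK23 d a b m := by
  have enum : ∀ a b : Fin 5, a ≠ b → ∃ x y z, Enumerates a b x y z := by
    unfold Enumerates
    decide
  by_cases hpos : ∀ i j, i ≠ j → 0 < d i j
  swap
  · push Not at hpos
    obtain ⟨a, b, hab, h0⟩ := hpos
    obtain ⟨x, y, z, h⟩ := enum a b hab
    exact ⟨a, b, 0, hp.eq_zero_of_dist_eq_zero hd h (le_antisymm h0 (hd.nonneg a b))⟩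
  obtain ⟨⟨a, b⟩, -, hmax⟩ := Finset.exists_max_image (univ : Finset (Fin 5 × Fin 5))
    (fun e => d e.1 e.2) ⟨(0, 0), mem_univ _⟩
  replace hmax : ∀ i j, d i j ≤ d a b := fun i j => hmax (i, j) (mem_univ _)
  have hab : a ≠ b := by
    rintro rfl
    have h1 := hmax 0 1
    have h2 := hpos 0 1 (by decide)
    rw [hd.self] at h1
    linarith
  obtain ⟨x, y, z, h⟩ := enum a b hab
  have hn := h.1
  simp only [List.nodup_cons, List.mem_cons, List.not_mem_nil, or_false, not_or] at hn
  have s0 := hd.symm b a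
  have s1 := hd.symm y x
  have s2 := hd.symm z x
  have s3 := hd.symm z y
  -- the points between which `a` and `b` lie are not at maximal distance from these
  have ha : d a x + d a y ≤ d x y ∨ d a x + d a z ≤ d x z ∨ d a y + d a z ≤ d y z := by
    have p1 := hpos a x (by tauto)
    have p2 := hpos a y (by tauto)
    have p3 := hpos a z (by tauto)
    have m1 := hmax b x
    have m2 := hmax b y
    have m3 := hmax b z
    rcases hp.single_cases hd h with q | q | q | q | q | q
    · linarith
    · linarith
    · linarith
    · exact Or.inl q
    · exact Or.inr (Or.inl q)
    · exact Or.inr (Or.inr q)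
  have hb : d b x + d b y ≤ d x y ∨ d b x + d b z ≤ d x z ∨ d b y + d b z ≤ d y z := by
    have p1 := hpos b x (by tauto)
    have p2 := hpos b y (by tauto)
    have p3 := hpos b z (by tauto)
    have m1 := hmax a x
    have m2 := hmax a y
    have m3 := hmax a z
    rcases hp.single_cases hd (h.perm (a' := b) (b' := a) (x' := x) (y' := y) (z' := z)) with
      q | q | q | q | q | q
    · linarith
    · linarith
    · linarith
    · exact Or.inl q
    · exact Or.inr (Or.inl q)
    · exact Or.inr (Or.inr q)
  have h1 : Enumerates a b x z y := h.perm
  have h2 : Enumerates a b y x z := h.perm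
  have h3 : Enumerates a b y z x := h.perm
  have h4 : Enumerates a b z x y := h.perm
  have h5 : Enumerates a b z y x := h.perm
  rcases ha with ha | ha | ha <;> rcases hb with hb | hb | hb
  · exact hp.isK23_of_between hd h hpos hmax ha hb
  · exact hp.isK23_of_between_of_between hd h hpos hmax ha hb
  · exact hp.isK23_of_between_of_between hd h2 hpos hmax (by linarith) hb
  · exact hp.isK23_of_between_of_between hd h1 hpos hmax ha hb
  · exact hp.isK23_of_between hd h1 hpos hmax ha hb
  · exact hp.isK23_of_between_of_between hd h4 hpos hmax (by linarith) (by linarith)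
  · exact hp.isK23_of_between_of_between hd h3 hpos hmax ha (by linarith)
  · exact hp.isK23_of_between_of_between hd h5 hpos hmax (by linarith) (by linarith)
  · exact hp.isK23_of_between hd h3 hpos hmax ha hb

end Prime

/-! ### Rounding by thresholds -/

section Rounding

/-- A random threshold in `(0, W)` separates two numbers with probability at most `W⁻¹` times their
distance, so some threshold is at least as good as the average. -/
theorem exists_threshold {ι : Type*} (s : Finset ι) (c l r : ι → ℝ) (hc : ∀ e ∈ s, 0 ≤ c e)
    {W : ℝ} (hW : 0 < W) :
    ∃ τ, 0 < τ ∧ τ < W ∧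
      W * ∑ e ∈ s, c e * |(if τ < l e then (1 : ℝ) else 0) - (if τ < r e then 1 else 0)| ≤
        ∑ e ∈ s, c e * |l e - r e| := by
  let F : ι → ℝ → ℝ := fun e => (Set.Ico (min (l e) (r e)) (max (l e) (r e))).indicator fun _ => 1
  have hF : ∀ e τ, |(if τ < l e then (1 : ℝ) else 0) - (if τ < r e then 1 else 0)| = F e τ := by
    intro e τ
    simp only [F, Set.indicator_apply, Set.mem_Ico, min_le_iff, lt_max_iff]
    by_cases h1 : τ < l e <;> by_cases h2 : τ < r e <;> simp [h1, h2, not_lt.1]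
  have hint : ∀ e, MeasureTheory.Integrable (F e) := fun e =>
    (MeasureTheory.integrable_indicator_iff measurableSet_Ico).2
      (MeasureTheory.integrableOn_const (by simp))
  have hval : ∀ e, ∫ τ in Set.Ioo 0 W, F e τ ≤ |l e - r e| := fun e => by
    refine (MeasureTheory.setIntegral_le_integral (hint e)
      (Filter.Eventually.of_forall fun τ =>
        Set.indicator_nonneg (fun _ _ => zero_le_one) _)).trans ?_
    rw [MeasureTheory.integral_indicator measurableSet_Ico]
    simp [max_sub_min_eq_abs']
  obtain ⟨τ, hτ, hle⟩ := MeasureTheory.exists_le_setAverage (μ := MeasureTheory.volume)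
    (s := Set.Ioo 0 W) (f := fun τ => ∑ e ∈ s, c e * F e τ) (by simp [hW]) (by simp)
    (MeasureTheory.integrable_finsetSum _ fun e _ => ((hint e).const_mul _).integrableOn)
  refine ⟨τ, hτ.1, hτ.2, ?_⟩
  simp only [hF]
  rw [MeasureTheory.setAverage_eq, MeasureTheory.integral_finsetSum _
    fun e _ => ((hint e).const_mul _).integrableOn] at hle
  have hvol : MeasureTheory.volume.real (Set.Ioo 0 W) = W := by simp [hW.le]
  rw [hvol, smul_eq_mul] at hle
  calc W * ∑ e ∈ s, c e * F e τ
      ≤ W * (W⁻¹ * ∑ e ∈ s, ∫ τ in Set.Ioo 0 W, c e * F e τ) :=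
        mul_le_mul_of_nonneg_left hle hW.le
    _ = ∑ e ∈ s, ∫ τ in Set.Ioo 0 W, c e * F e τ := by
        rw [← mul_assoc, mul_inv_cancel₀ hW.ne', one_mul]
    _ ≤ ∑ e ∈ s, c e * |l e - r e| := by
        refine sum_le_sum fun e he => ?_
        rw [MeasureTheory.integral_const_mul]
        exact mul_le_mul_of_nonneg_left (hval e) (hc e he)

/-- The tight span of `m` times `K_{2,3}` consists of three triangles with the common side `a b`
and the third vertices `i ∉ {a, b}`. A point of the triangle at `i` is given by the two numbers
`f a ± (m - f i)`; a threshold `τ` rounds it to `b`, `i` or `a` according to how many of them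
exceed `τ`. -/
theorem IsK23.exists_rounding {d : Fin 5 → Fin 5 → ℝ} {a b : Fin 5} {m : ℝ} (h : IsK23 d a b m)
    (hd : IsSemimetric d) (hm : 0 < m) {ι : Type*} (s : Finset ι) (c M : ι → ℝ)
    (hc : ∀ e ∈ s, 0 ≤ c e) (f g : ι → Fin 5 → ℝ) (hf : ∀ e ∈ s, Tight d (f e))
    (hg : ∀ e ∈ s, Tight d (g e)) (hM : ∀ e ∈ s, ∀ i, |f e i - g e i| ≤ M e) :
    ∃ κ : (Fin 5 → ℝ) → Fin 5,
      (∑ e ∈ s, c e * d (κ (f e)) (κ (g e)) ≤ ∑ e ∈ s, c e * M e) ∧ (∀ t, κ (d t) = t) ∧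
      ∀ f, Tight d f → ∀ p i, p = a ∨ p = b → i ≠ a → i ≠ b → f p + f i = d p i →
        κ f = p ∨ κ f = i := by
  have hflap : ∀ f : Fin 5 → ℝ, ∃ i, i ≠ a ∧ i ≠ b ∧ ∀ j, j ≠ a → j ≠ b → f i ≤ f j := by
    intro f
    obtain ⟨i₀, hi₀⟩ : ∃ i : Fin 5, i ≠ a ∧ i ≠ b :=
      (by decide : ∀ a b : Fin 5, ∃ i : Fin 5, i ≠ a ∧ i ≠ b) a b
    obtain ⟨i, hi, hmin⟩ := exists_min_image (univ.filter fun i => i ≠ a ∧ i ≠ b) f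
      ⟨i₀, by simpa using hi₀⟩
    simp only [mem_filter, mem_univ, true_and] at hi
    exact ⟨i, hi.1, hi.2, fun j h1 h2 => hmin j (by simp [h1, h2])⟩
  choose φ hφa hφb hφ using hflap
  let σ : (Fin 5 → ℝ) → ℝ := fun f => max 0 (m - f (φ f))
  let lo : (Fin 5 → ℝ) → ℝ := fun f => f a - σ f
  let hi : (Fin 5 → ℝ) → ℝ := fun f => f a + σ f
  have σ_nonneg : ∀ f, 0 ≤ σ f := fun f => le_max_left _ _
  -- the partners of the two numbers of `f` among those of `g`: exchanged between two triangles
  let lo' : (Fin 5 → ℝ) → (Fin 5 → ℝ) → ℝ := fun f g => if φ f = φ g then lo g else hi g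
  let hi' : (Fin 5 → ℝ) → (Fin 5 → ℝ) → ℝ := fun f g => if φ f = φ g then hi g else lo g
  have hdist : ∀ f g, Tight d f → Tight d g → ∀ M, (∀ i, |f i - g i| ≤ M) →
      |lo f - lo' f g| + |hi f - hi' f g| ≤ 2 * M := by
    intro f g hf hg M hM
    have ha := abs_le.1 (hM a)
    by_cases heq : φ f = φ g
    · have hs : |σ f - σ g| ≤ M := by
        have := abs_le.1 (hM (φ g))
        simp only [σ, heq]
        rw [abs_le]
        constructor
        · rcases max_cases 0 (m - f (φ g)) with ⟨e1, e2⟩ | ⟨e1, e2⟩ <;>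
            rcases max_cases 0 (m - g (φ g)) with ⟨e3, e4⟩ | ⟨e3, e4⟩ <;> rw [e1, e3] <;> linarith
        · rcases max_cases 0 (m - f (φ g)) with ⟨e1, e2⟩ | ⟨e1, e2⟩ <;>
            rcases max_cases 0 (m - g (φ g)) with ⟨e3, e4⟩ | ⟨e3, e4⟩ <;> rw [e1, e3] <;> linarith
      have hs := abs_le.1 hs
      simp only [lo', hi', lo, hi, heq, if_true]
      rcases abs_cases (f a - σ f - (g a - σ g)) with ⟨e1, _⟩ | ⟨e1, _⟩ <;>
        rcases abs_cases (f a + σ f - (g a + σ g)) with ⟨e2, _⟩ | ⟨e2, _⟩ <;>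
        rw [e1, e2] <;> linarith
    · have hs : σ f + σ g ≤ M := by
        have h1 := hf.le (φ f) (φ g)
        have h2 := hg.le (φ f) (φ g)
        rw [h.other _ _ (hφa f) (hφb f) (hφa g) (hφb g) heq] at h1 h2
        have h3 := abs_le.1 (hM (φ f))
        have h4 := abs_le.1 (hM (φ g))
        have h5 := hφ f (φ g) (hφa g) (hφb g)
        have h6 := hφ g (φ f) (hφa f) (hφb f)
        simp only [σ]
        rcases max_cases 0 (m - f (φ f)) with ⟨e1, e2⟩ | ⟨e1, e2⟩ <;>
          rcases max_cases 0 (m - g (φ g)) with ⟨e3, e4⟩ | ⟨e3, e4⟩ <;> rw [e1, e3] <;> linarith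
      have h1 := σ_nonneg f
      have h2 := σ_nonneg g
      simp only [lo', hi', lo, hi, heq, if_false]
      rcases abs_cases (f a - σ f - (g a + σ g)) with ⟨e1, _⟩ | ⟨e1, _⟩ <;>
        rcases abs_cases (f a + σ f - (g a - σ g)) with ⟨e2, _⟩ | ⟨e2, _⟩ <;>
        rw [e1, e2] <;> linarith
  obtain ⟨τ, hτ0, hτ, hle⟩ := exists_threshold (s ×ˢ (univ : Finset Bool)) (fun k => c k.1)
    (fun k => if k.2 then lo (f k.1) else hi (f k.1))
    (fun k => if k.2 then lo' (f k.1) (g k.1) else hi' (f k.1) (g k.1))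
    (fun k hk => hc _ (mem_product.1 hk).1) (W := 2 * m) (by linarith)
  let κ : (Fin 5 → ℝ) → Fin 5 := fun f => if τ < lo f then b else if τ < hi f then φ f else a
  have lo_le_hi : ∀ f, lo f ≤ hi f := fun f => by
    have := σ_nonneg f
    simp only [lo, hi]
    linarith
  refine ⟨κ, ?_, ?_, ?_⟩
  · have hκ : ∀ f g, d (κ f) (κ g) ≤
        m * (|(if τ < lo f then (1 : ℝ) else 0) - (if τ < lo' f g then 1 else 0)| +
          |(if τ < hi f then (1 : ℝ) else 0) - (if τ < hi' f g then 1 else 0)|) := by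
      intro f g
      have lf := lo_le_hi f
      have lg := lo_le_hi g
      have e1 := h.left_right
      have e2 := hd.symm b a
      have e3 := h.left _ (hφa f) (hφb f)
      have e4 := h.right _ (hφa f) (hφb f)
      have e5 := h.left _ (hφa g) (hφb g)
      have e6 := h.right _ (hφa g) (hφb g)
      have e7 := hd.symm (φ f) a
      have e8 := hd.symm (φ f) b
      have n0 := hd.self
      by_cases heq : φ f = φ g
      · simp only [κ, lo', hi', heq, if_true] at *
        split_ifs <;> first
          | (norm_num [n0]; done)
          | (norm_num [n0]; linarith)
      · have e9 := h.other _ _ (hφa f) (hφb f) (hφa g) (hφb g) heq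
        simp only [κ, lo', hi', heq, if_false]
        split_ifs <;> first
          | (norm_num [n0]; done)
          | (norm_num [n0]; linarith)
    have hsum : 2 * m * ∑ e ∈ s, c e *
        (|(if τ < lo (f e) then (1 : ℝ) else 0) - (if τ < lo' (f e) (g e) then 1 else 0)| +
          |(if τ < hi (f e) then (1 : ℝ) else 0) - (if τ < hi' (f e) (g e) then 1 else 0)|) ≤
        ∑ e ∈ s, c e * (|lo (f e) - lo' (f e) (g e)| + |hi (f e) - hi' (f e) (g e)|) := by
      simpa [sum_product, mul_add] using hle
    have h2 : ∑ e ∈ s, c e * (|lo (f e) - lo' (f e) (g e)| + |hi (f e) - hi' (f e) (g e)|) ≤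
        2 * ∑ e ∈ s, c e * M e := by
      rw [mul_sum]
      refine sum_le_sum fun e he => ?_
      have := mul_le_mul_of_nonneg_left (hdist _ _ (hf e he) (hg e he) _ (hM e he)) (hc e he)
      linarith
    have h3 := sum_le_sum fun e he => mul_le_mul_of_nonneg_left (hκ (f e) (g e)) (hc e he)
    have h4 : ∀ x : ι → ℝ, ∑ e ∈ s, c e * (m * x e) = m * ∑ e ∈ s, c e * x e := fun x => by
      rw [mul_sum]
      exact sum_congr rfl fun e _ => by ring
    rw [h4] at h3
    linarith
  · intro t
    by_cases hta : t = a
    · subst hta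
      have e : d t (φ (d t)) = m := h.left _ (hφa _) (hφb _)
      have h1 : ¬τ < lo (d t) := by simp [lo, σ, e, hd.self, hτ0.le]
      have h2 : ¬τ < hi (d t) := by simp [hi, σ, e, hd.self, hτ0.le]
      simp only [κ, h1, h2, if_false]
    by_cases htb : t = b
    · subst htb
      have e : d t (φ (d t)) = m := h.right _ (hφa _) (hφb _)
      have h1 : τ < lo (d t) := by simp [lo, σ, e, hd.symm t a, h.left_right, hτ]
      simp only [κ, h1, if_true]
    · have e : φ (d t) = t := by
        by_contra hne
        have := hφ (d t) t hta htb
        rw [hd.self, h.other _ _ hta htb (hφa _) (hφb _) (Ne.symm hne)] at this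
        linarith
      have h1 : ¬τ < lo (d t) := by
        simp [lo, σ, e, hd.symm t a, h.left t hta htb, hd.self, hm.le, hτ0.le]
      have h2 : τ < hi (d t) := by
        simp [hi, σ, e, hd.symm t a, h.left t hta htb, hd.self, hm.le]
        linarith
      simp only [κ, h1, h2, if_true, if_false, e]
  · intro f hf p i hp hia hib hpi
    have hab := hf.le a b
    rw [h.left_right] at hab
    -- the third vertex `j` of another triangle is at distance at most `m` from `f` only if `f` lies
    -- on the common side of the triangles
    have hσ : ∀ j, j ≠ a → j ≠ b → φ f ≠ j → f j ≤ m → σ f = m - f j ∧ m = f j := by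
      intro j hja hjb hne hj
      have h1 := hf.le (φ f) j
      rw [h.other _ _ (hφa f) (hφb f) hja hjb hne] at h1
      have h2 := hφ f j hja hjb
      have : m = f j := by linarith
      refine ⟨?_, this⟩
      simp only [σ]
      rw [max_eq_left] <;> linarith
    have hpn := hf.nonneg hd p
    have hφi : (φ f = i ∧ σ f = m - f i) ∨ (σ f = 0 ∧ f p = 0) := by
      have hpim : d p i = m := by
        rcases hp with rfl | rfl
        · exact h.left i hia hib
        · exact h.right i hia hib
      rw [hpim] at hpi
      by_cases he : φ f = i
      · left
        refine ⟨he, ?_⟩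
        simp only [σ, he]
        exact max_eq_right (by linarith)
      · right
        obtain ⟨h1, h2⟩ := hσ i hia hib he (by linarith)
        constructor <;> linarith
    rcases hp with rfl | rfl
    · rw [h.left i hia hib] at hpi
      rcases hφi with ⟨h1, h2⟩ | ⟨h1, h2⟩
      · have h3 : ¬τ < lo f := by
          simp only [lo]
          linarith
        simp only [κ, h3, if_false, h1]
        split_ifs <;> simp
      · have h3 : ¬τ < lo f := by
          simp only [lo]
          linarith
        have h4 : ¬τ < hi f := by
          simp only [hi]
          linarith
        simp only [κ, h3, h4, if_false, true_or]
    · rw [h.right i hia hib] at hpi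
      rcases hφi with ⟨h1, h2⟩ | ⟨h1, h2⟩
      · have h3 : τ < hi f := by
          simp only [hi]
          linarith
        simp only [κ, h3, if_true, h1]
        split_ifs <;> simp
      · have h3 : τ < lo f := by
          simp only [lo]
          linarith
        simp only [κ, h3, if_true, true_or]

end Rounding

/-! ### Rounding the tight span of five points -/

section Core

/-- The trivial splits of five points. -/
def singleSplits : List (Fin 5 × Fin 5) := (List.finRange 5).map fun t => (t, t)

/-- The splits of five points with sides of two and three points. -/
def pairSplits : List (Fin 5 × Fin 5) :=
  (List.finRange 5 ×ˢ List.finRange 5).filter fun S => S.1 < S.2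

/-- All splits of five points, the trivial ones first. -/
def allSplits : List (Fin 5 × Fin 5) := singleSplits ++ pairSplits

theorem nodup_allSplits : allSplits.Nodup := by decide

theorem mem_singleSplits (t : Fin 5) : (t, t) ∈ singleSplits := by simp [singleSplits]

theorem mem_pairSplits {S : Fin 5 × Fin 5} : S ∈ pairSplits ↔ S.1 < S.2 := by
  revert S
  decide

theorem mem_allSplits {S : Fin 5 × Fin 5} :
    S ∈ allSplits ↔ S ∈ pairSplits ∨ ∃ t, S = (t, t) := by
  revert S
  decide

theorem MaxPairing.swap_left {N : Type*} {d : N → N → ℝ} (hd : IsSemimetric d) {p q i j : N}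
    (h : MaxPairing d p q i j) : MaxPairing d q p i j := by
  unfold MaxPairing at *
  rw [hd.symm q p]
  constructor <;> linarith

theorem MaxPairing.swap {N : Type*} {d : N → N → ℝ} (hd : IsSemimetric d) {p q i j : N}
    (h : MaxPairing d p q i j) : MaxPairing d i j p q := by
  unfold MaxPairing at *
  have := hd.symm p i
  have := hd.symm p j
  have := hd.symm q i
  have := hd.symm q j
  constructor <;> linarith

/-- One of the three pairings of four points is a maximal one. -/
theorem maxPairing_cases {N : Type*} {d : N → N → ℝ} (hd : IsSemimetric d) (p q i j : N) :
    MaxPairing d p q i j ∨ MaxPairing d p i q j ∨ MaxPairing d p j q i := by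
  unfold MaxPairing
  have := hd.symm q i
  have := hd.symm q j
  have := hd.symm i j
  rcases le_total (d p q + d i j) (d p i + d q j) with h1 | h1 <;>
    rcases le_total (d p q + d i j) (d p j + d q i) with h2 | h2 <;>
    rcases le_total (d p i + d q j) (d p j + d q i) with h3 | h3
  all_goals first
    | (left; constructor <;> linarith)
    | (right; left; constructor <;> linarith)
    | (right; right; constructor <;> linarith)

variable {d : Fin 5 → Fin 5 → ℝ}

theorem SplitDecomposition.isPrime_rest (D : SplitDecomposition d allSplits) : IsPrime D.rest where
  pair p q hpq := by
    rcases lt_or_gt_of_ne hpq with h | h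
    · obtain ⟨i, j, hi, hj, hij, hm⟩ := D.exists_maxPairing (p, q)
        (mem_allSplits.2 (Or.inl (mem_pairSplits.2 h)))
      simp only [mem_side, not_or] at hi hj
      exact ⟨i, j, hi.1, hi.2, hj.1, hj.2, hij, hm⟩
    · obtain ⟨i, j, hi, hj, hij, hm⟩ := D.exists_maxPairing (q, p)
        (mem_allSplits.2 (Or.inl (mem_pairSplits.2 h)))
      simp only [mem_side, not_or] at hi hj
      exact ⟨i, j, hi.2, hi.1, hj.2, hj.1, hij, hm.swap_left D.isSemimetric_rest⟩
  single p := by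
    obtain ⟨i, j, hi, hj, hij, hm⟩ := D.exists_maxPairing (p, p) (mem_allSplits.2 (Or.inr ⟨p, rfl⟩))
    simp only [mem_side, not_or] at hi hj
    have := hm.1
    rw [D.isSemimetric_rest.self, zero_add] at this
    exact ⟨i, j, hi.1, hj.1, hij, this⟩

/-- The strips of two splits with disjoint small sides are disjoint. -/
theorem SplitDecomposition.not_pos_and_pos {N : Type*} [DecidableEq N] {d : N → N → ℝ}
    {L : List (N × N)} (D : SplitDecomposition d L) {S S' : N × N} (hS : S ∈ L) (hS' : S' ∈ L)
    (hdisj : ∀ t, t ∈ side S → t ∉ side S') (f : N → ℝ) (hf : Tight d f) :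
    ¬(0 < D.coord S f ∧ 0 < D.coord S' f) := by
  let R : N × N → N × N → Prop := fun S S' => (∀ t, t ∈ side S → t ∉ side S') →
    ∀ f, Tight d f → ¬(0 < D.coord S f ∧ 0 < D.coord S' f)
  have hR : L.Pairwise R := by
    refine D.pairwise.imp_of_mem fun {S S'} _ hS' H hdisj f hf hpos => ?_
    have h1 := hdisj _ (left_mem_side S)
    have h2 := H f hf hpos.1 (iff_of_false h1 (hdisj _ (right_mem_side S)))
    rw [D.coord_row_of_notMem S' hS' h1] at h2
    exact hpos.2.ne' h2
  have hsymm : Std.Symm R := ⟨fun S S' H hdisj f hf hpos =>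
    H (fun t h h' => hdisj t h' h) f hf hpos.symm⟩
  have hne : S ≠ S' := by
    rintro rfl
    exact hdisj _ (left_mem_side S) (left_mem_side S)
  exact hR.forall hS hS' hne hdisj f hf

/-- The pair splits of positive weight that contain `t`. -/
noncomputable def SplitDecomposition.star (D : SplitDecomposition d allSplits) (t : Fin 5) :
    Finset (Fin 5 × Fin 5) :=
  pairSplits.toFinset.filter fun S => 0 < D.w S ∧ t ∈ side S

theorem SplitDecomposition.mem_star (D : SplitDecomposition d allSplits) {t : Fin 5}
    {S : Fin 5 × Fin 5} : S ∈ D.star t ↔ S ∈ pairSplits ∧ 0 < D.w S ∧ t ∈ side S := by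
  simp [star]

theorem exists_other_mem_side {S : Fin 5 × Fin 5} (hS : S ∈ pairSplits) {t : Fin 5}
    (ht : t ∈ side S) : ∃ x, x ≠ t ∧ x ∈ side S := by
  have := mem_pairSplits.1 hS
  rcases mem_side.1 ht with rfl | rfl
  · exact ⟨S.2, this.ne', right_mem_side S⟩
  · exact ⟨S.1, this.ne, left_mem_side S⟩

theorem eq_of_mem_side {S S' : Fin 5 × Fin 5} (hS : S ∈ pairSplits) (hS' : S' ∈ pairSplits)
    {t x : Fin 5} (hxt : x ≠ t) (ht : t ∈ side S) (hx : x ∈ side S) (ht' : t ∈ side S')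
    (hx' : x ∈ side S') : S = S' := by
  rw [mem_pairSplits] at hS hS'
  rw [mem_side] at *
  obtain ⟨p, q⟩ := S
  obtain ⟨p', q'⟩ := S'
  simp only [Prod.mk.injEq] at *
  omega

theorem SplitDecomposition.not_maxPairing (D : SplitDecomposition d allSplits)
    (hd : IsSemimetric d) {S : Fin 5 × Fin 5} (hS : S ∈ pairSplits) (hw : 0 < D.w S)
    {p q i j : Fin 5} (hpq : p ≠ q) (hp : p ∈ side S) (hq : q ∈ side S) (hip : i ≠ p) (hiq : i ≠ q)
    (hjp : j ≠ p) (hjq : j ≠ q) (hij : i ≠ j) : ¬MaxPairing d p q i j := by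
  have H := fun i j hi hj hij =>
    (D.of_pos S (mem_allSplits.2 (Or.inl hS)) hw i j hi hj hij).1
  intro hm
  rcases mem_side.1 hp with rfl | rfl <;> rcases mem_side.1 hq with rfl | rfl
  · exact hpq rfl
  · exact H i j (by simp [mem_side, *]) (by simp [mem_side, *]) hij hm
  · exact H i j (by simp [mem_side, *]) (by simp [mem_side, *]) hij (hm.swap_left hd)
  · exact hpq rfl

/-- Three pairs at `t` would exclude all three pairings of the four points in question. -/
theorem SplitDecomposition.card_star_le (D : SplitDecomposition d allSplits)
    (hd : IsSemimetric d) (t : Fin 5) : (D.star t).card ≤ 2 := by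
  by_contra! hcard
  obtain ⟨S₁, S₂, S₃, h₁, h₂, h₃, h₁₂, h₁₃, h₂₃⟩ := two_lt_card_iff.1 hcard
  obtain ⟨p₁, w₁, t₁⟩ := D.mem_star.1 h₁
  obtain ⟨p₂, w₂, t₂⟩ := D.mem_star.1 h₂
  obtain ⟨p₃, w₃, t₃⟩ := D.mem_star.1 h₃
  obtain ⟨x, hxt, hx⟩ := exists_other_mem_side p₁ t₁
  obtain ⟨y, hyt, hy⟩ := exists_other_mem_side p₂ t₂
  obtain ⟨z, hzt, hz⟩ := exists_other_mem_side p₃ t₃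
  have hxy : x ≠ y := by
    rintro rfl
    exact h₁₂ (eq_of_mem_side p₁ p₂ hxt t₁ hx t₂ hy)
  have hxz : x ≠ z := by
    rintro rfl
    exact h₁₃ (eq_of_mem_side p₁ p₃ hxt t₁ hx t₃ hz)
  have hyz : y ≠ z := by
    rintro rfl
    exact h₂₃ (eq_of_mem_side p₂ p₃ hyt t₂ hy t₃ hz)
  rcases maxPairing_cases hd t x y z with h | h | h
  · exact D.not_maxPairing hd p₁ w₁ hxt.symm t₁ hx hyt hxy.symm hzt hxz.symm hyz h
  · exact D.not_maxPairing hd p₂ w₂ hyt.symm t₂ hy hxt hxy hzt hyz.symm hxz h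
  · exact D.not_maxPairing hd p₃ w₃ hzt.symm t₃ hz hxt hxz hyt hyz hxy h

/-- Pairs of positive weight do not form a triangle. -/
theorem SplitDecomposition.mem_side_of_inter (D : SplitDecomposition d allSplits)
    (hd : IsSemimetric d) {S₁ S₂ S₃ : Fin 5 × Fin 5} {t : Fin 5} (h₁ : S₁ ∈ D.star t)
    (h₂ : S₂ ∈ D.star t) (h₁₂ : S₁ ≠ S₂) (p₃ : S₃ ∈ pairSplits) (w₃ : 0 < D.w S₃)
    (h₁₃ : ∃ x ∈ side S₁, x ∈ side S₃) (h₂₃ : ∃ y ∈ side S₂, y ∈ side S₃) : t ∈ side S₃ := by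
  by_contra ht
  obtain ⟨p₁, w₁, t₁⟩ := D.mem_star.1 h₁
  obtain ⟨p₂, w₂, t₂⟩ := D.mem_star.1 h₂
  obtain ⟨x, hx₁, hx₃⟩ := h₁₃
  obtain ⟨y, hy₂, hy₃⟩ := h₂₃
  have hxt : x ≠ t := fun h => ht (h ▸ hx₃)
  have hyt : y ≠ t := fun h => ht (h ▸ hy₃)
  have hxy : x ≠ y := by
    rintro rfl
    exact h₁₂ (eq_of_mem_side p₁ p₂ hxt t₁ hx₁ t₂ hy₂)
  obtain ⟨u, hut, hux, huy⟩ : ∃ u : Fin 5, u ≠ t ∧ u ≠ x ∧ u ≠ y :=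
    (by decide : ∀ t x y : Fin 5, ∃ u : Fin 5, u ≠ t ∧ u ≠ x ∧ u ≠ y) t x y
  rcases maxPairing_cases hd t x y u with h | h | h
  · exact D.not_maxPairing hd p₁ w₁ hxt.symm t₁ hx₁ hyt hxy.symm hut hux huy.symm h
  · exact D.not_maxPairing hd p₂ w₂ hyt.symm t₂ hy₂ hxt hxy hut huy hux.symm h
  · exact D.not_maxPairing hd p₃ w₃ hxy hx₃ hy₃ hxt.symm hyt.symm hux huy hut.symm (h.swap hd)

/-- A pair of positive weight joins the two classes of the remainder `K_{2,3}`. -/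
theorem SplitDecomposition.mixed (D : SplitDecomposition d allSplits) {a b : Fin 5} {m : ℝ}
    (h : IsK23 D.rest a b m) (hm : 0 < m) {S : Fin 5 × Fin 5} (hS : S ∈ pairSplits)
    (hw : 0 < D.w S) :
    ((S.1 = a ∨ S.1 = b) ∧ S.2 ≠ a ∧ S.2 ≠ b) ∨ ((S.2 = a ∨ S.2 = b) ∧ S.1 ≠ a ∧ S.1 ≠ b) := by
  have hlt := (mem_pairSplits.1 hS).ne
  have H := fun i j hi hj hij =>
    (D.of_pos S (mem_allSplits.2 (Or.inl hS)) hw i j hi hj hij).2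
  have hsymm := D.isSemimetric_rest.symm
  have hab := h.ne
  have hlr := h.left_right
  unfold NotStrictMax at H
  by_cases h1 : S.1 = a ∨ S.1 = b <;> by_cases h2 : S.2 = a ∨ S.2 = b
  · obtain ⟨i, j, hia, hib, hja, hjb, hij⟩ :=
      (by decide : ∀ a b : Fin 5, ∃ i j : Fin 5, i ≠ a ∧ i ≠ b ∧ j ≠ a ∧ j ≠ b ∧ i ≠ j) a b
    have hi : i ∉ side S := by
      rw [mem_side]
      rcases h1 with e | e <;> rcases h2 with e' | e' <;> simp [e, e', hia, hib]
    have hj : j ∉ side S := by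
      rw [mem_side]
      rcases h1 with e | e <;> rcases h2 with e' | e' <;> simp [e, e', hja, hjb]
    have := H i j hi hj hij
    have e1 := h.left i hia hib
    have e2 := h.left j hja hjb
    have e3 := h.right i hia hib
    have e4 := h.right j hja hjb
    have e5 := h.other i j hia hib hja hjb hij
    have e6 := hsymm b a
    rcases h1 with e | e <;> rcases h2 with e' | e'
    · exact absurd (e.trans e'.symm) hlt
    · rw [e, e'] at this
      rcases le_max_iff.1 this with h | h <;> linarith
    · rw [e, e'] at this
      rcases le_max_iff.1 this with h | h <;> linarith
    · exact absurd (e.trans e'.symm) hlt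
  · exact Or.inl ⟨h1, not_or.1 h2⟩
  · exact Or.inr ⟨h2, not_or.1 h1⟩
  · rw [not_or] at h1 h2
    have := H a b (by simp [mem_side, Ne.symm h1.1, Ne.symm h2.1])
      (by simp [mem_side, Ne.symm h1.2, Ne.symm h2.2]) hab
    have e1 := h.left S.1 h1.1 h1.2
    have e2 := h.left S.2 h2.1 h2.2
    have e3 := h.right S.1 h1.1 h1.2
    have e4 := h.right S.2 h2.1 h2.2
    have e5 := h.other _ _ h1.1 h1.2 h2.1 h2.2 hlt
    rw [hsymm S.1 a, hsymm S.2 b, hsymm S.1 b, hsymm S.2 a] at this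
    rcases le_max_iff.1 this with h | h <;> linarith

/-- The weighted sum of the cut semimetrics that separate the sets `A` and `B` of splits, plus the
distance of the second components. -/
noncomputable def gridDist (T : Finset (Fin 5 × Fin 5)) (w : Fin 5 × Fin 5 → ℝ)
    (ρ : Fin 5 → Fin 5 → ℝ) (x y : Finset (Fin 5 × Fin 5) × Fin 5) : ℝ :=
  ∑ S ∈ T, w S * |(if S ∈ x.1 then (1 : ℝ) else 0) - (if S ∈ y.1 then 1 else 0)| + ρ x.2 y.2

theorem isSemimetric_gridDist {T : Finset (Fin 5 × Fin 5)} {w : Fin 5 × Fin 5 → ℝ}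
    (hw : ∀ S ∈ T, 0 ≤ w S) {ρ : Fin 5 → Fin 5 → ℝ} (hρ : IsSemimetric ρ) :
    IsSemimetric (gridDist T w ρ) where
  nonneg x y := add_nonneg (sum_nonneg fun S hS => mul_nonneg (hw S hS) (abs_nonneg _))
    (hρ.nonneg _ _)
  self x := by simp [gridDist, hρ.self]
  symm x y := by
    unfold gridDist
    rw [hρ.symm]
    congr 1
    exact sum_congr rfl fun S _ => by rw [abs_sub_comm]
  triangle x y z := by
    have h1 := hρ.triangle x.2 y.2 z.2
    have h2 : ∀ S ∈ T, w S * |(if S ∈ x.1 then (1 : ℝ) else 0) - (if S ∈ z.1 then 1 else 0)| ≤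
        w S * |(if S ∈ x.1 then (1 : ℝ) else 0) - (if S ∈ y.1 then 1 else 0)| +
        w S * |(if S ∈ y.1 then (1 : ℝ) else 0) - (if S ∈ z.1 then 1 else 0)| := fun S hS => by
      rw [← mul_add]
      exact mul_le_mul_of_nonneg_left (abs_sub_le _ _ _) (hw S hS)
    have h3 := sum_le_sum h2
    rw [sum_add_distrib] at h3
    unfold gridDist
    linarith

/-- The tight span of a semimetric on five points can be rounded to the five points and at most
twenty others, at no loss for a given weighted sum of distances. -/
theorem exists_tightSpan_rounding (hd : IsSemimetric d) {ι : Type*} (s : Finset ι) (c M : ι → ℝ)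
    (hc : ∀ e ∈ s, 0 ≤ c e) (f g : ι → Fin 5 → ℝ) (hf : ∀ e ∈ s, Tight d (f e))
    (hg : ∀ e ∈ s, Tight d (g e)) (hM : ∀ e ∈ s, ∀ i, |f e i - g e i| ≤ M e) :
    ∃ (δ : Finset (Fin 5 × Fin 5) × Fin 5 → Finset (Fin 5 × Fin 5) × Fin 5 → ℝ)
      (pos : (Fin 5 → ℝ) → Finset (Fin 5 × Fin 5) × Fin 5)
      (Z : Finset (Finset (Fin 5 × Fin 5) × Fin 5)),
      IsSemimetric δ ∧ (∀ t t', δ (pos (d t)) (pos (d t')) = d t t') ∧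
      ∑ e ∈ s, c e * δ (pos (f e)) (pos (g e)) ≤ ∑ e ∈ s, c e * M e ∧
      Z.card ≤ 20 ∧ ∀ f, Tight d f → (∃ t, pos f = pos (d t)) ∨ pos f ∈ Z := by
  obtain ⟨D⟩ := nonempty_splitDecomposition (by simp) nodup_allSplits hd
  have hrest := D.isSemimetric_rest
  obtain ⟨a, b, m, hK⟩ := D.isPrime_rest.exists_isK23 hrest
  -- what the splits leave of the distance bound
  let M' : ι → ℝ := fun e =>
    M e - ∑ S ∈ allSplits.toFinset, |D.coord S (f e) - D.coord S (g e)|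
  have hM' : ∀ e ∈ s, ∀ i, |D.proj (f e) i - D.proj (g e) i| ≤ M' e := fun e he i => by
    have := D.lipschitz (hf e he) (hg e he) (hM e he) i
    simp only [M']
    linarith
  -- rounding the component in the tight span of the remainder
  obtain ⟨κ, hκsum, hκrow, hκ⟩ : ∃ κ : (Fin 5 → ℝ) → Fin 5,
      (∑ e ∈ s, c e * D.rest (κ (D.proj (f e))) (κ (D.proj (g e))) ≤ ∑ e ∈ s, c e * M' e) ∧
      (∀ t t', D.rest (κ (D.rest t)) (κ (D.rest t')) = D.rest t t') ∧
      ((m = 0 ∧ ∀ f, κ f = a) ∨ (0 < m ∧ ∀ f, Tight D.rest f → ∀ p i, p = a ∨ p = b → i ≠ a →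
        i ≠ b → f p + f i = D.rest p i → κ f = p ∨ κ f = i)) := by
    rcases hK.nonneg.eq_or_lt with hm | hm
    · have h0 : ∀ i j, D.rest i j = 0 := by
        intro i j
        have h1 : ∀ i, D.rest a i = 0 := fun i => by
          by_cases hi : i = a
          · rw [hi, hrest.self]
          by_cases hi' : i = b
          · rw [hi', hK.left_right, ← hm, mul_zero]
          · rw [hK.left i hi hi', ← hm]
        have h2 := hrest.triangle i a j
        rw [hrest.symm i a, h1, h1] at h2
        linarith [hrest.nonneg i j]
      refine ⟨fun _ => a, ?_, fun t t' => by rw [h0, h0], Or.inl ⟨hm.symm, fun _ => rfl⟩⟩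
      refine sum_le_sum fun e he => mul_le_mul_of_nonneg_left ?_ (hc e he)
      rw [h0]
      exact (abs_nonneg _).trans (hM' e he a)
    · obtain ⟨κ, h1, h2, h3⟩ := hK.exists_rounding hrest hm s c M' hc (fun e => D.proj (f e))
        (fun e => D.proj (g e)) (fun e he => D.tight_proj (hf e he))
        (fun e he => D.tight_proj (hg e he)) hM'
      exact ⟨κ, h1, fun t t' => by rw [h2, h2], Or.inr ⟨hm, h3⟩⟩
  -- rounding the coordinate of each split
  have hθ : ∀ S, ∃ θ, S ∈ allSplits → 0 ≤ θ ∧ (0 < D.w S → θ < D.w S) ∧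
      D.w S * ∑ e ∈ s, c e * |(if θ < D.coord S (f e) then (1 : ℝ) else 0) -
        (if θ < D.coord S (g e) then 1 else 0)| ≤
          ∑ e ∈ s, c e * |D.coord S (f e) - D.coord S (g e)| := by
    intro S
    by_cases hw : 0 < D.w S
    · obtain ⟨θ, h0, h1, h2⟩ := exists_threshold s c (fun e => D.coord S (f e))
        (fun e => D.coord S (g e)) hc hw
      exact ⟨θ, fun _ => ⟨h0.le, fun _ => h1, h2⟩⟩
    · refine ⟨0, fun hS => ⟨le_rfl, fun h => absurd h hw, ?_⟩⟩
      rw [le_antisymm (not_lt.1 hw) (D.w_nonneg S hS), zero_mul]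
      exact sum_nonneg fun e he => mul_nonneg (hc e he) (abs_nonneg _)
  choose θ hθ using hθ
  let A : (Fin 5 → ℝ) → Finset (Fin 5 × Fin 5) := fun f =>
    allSplits.toFinset.filter fun S => θ S < D.coord S f
  let pos : (Fin 5 → ℝ) → Finset (Fin 5 × Fin 5) × Fin 5 := fun f => (A f, κ (D.proj f))
  have mem_A : ∀ f S, S ∈ A f ↔ S ∈ allSplits ∧ θ S < D.coord S f := fun f S => by simp [A]
  have coord_pos : ∀ {f S}, S ∈ A f → 0 < D.coord S f := fun {f S} h =>
    (hθ S ((mem_A f S).1 h).1).1.trans_lt ((mem_A f S).1 h).2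
  have w_pos : ∀ {f S}, Tight d f → S ∈ A f → 0 < D.w S := fun {f S} hf h =>
    (coord_pos h).trans_le (D.coord_le S ((mem_A f S).1 h).1 hf)
  have mem_A_row : ∀ S ∈ allSplits, 0 < D.w S → ∀ t, (S ∈ A (d t) ↔ t ∈ side S) := by
    intro S hS hw t
    rw [mem_A]
    by_cases ht : t ∈ side S
    · simp [ht, hS, D.coord_row_of_mem S hS ht, (hθ S hS).2.1 hw]
    · simp [ht, D.coord_row_of_notMem S hS ht, (hθ S hS).1]
  have inter : ∀ f, Tight d f → ∀ S S', S ∈ A f → S' ∈ A f → ∃ t ∈ side S, t ∈ side S' := by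
    intro f hf S S' hS hS'
    by_contra! h
    exact D.not_pos_and_pos ((mem_A f S).1 hS).1 ((mem_A f S').1 hS').1 h f hf
      ⟨coord_pos hS, coord_pos hS'⟩
  -- the vertices of the grid that are not terminals
  let k : Fin 5 → Fin 5 := fun t => if 0 < m then t else a
  let Z : Finset (Finset (Fin 5 × Fin 5) × Fin 5) :=
    univ.image (fun i => (∅, i)) ∪
      ((univ.biUnion fun t => (D.star t).image fun S => ({S}, k t)) ∪
        univ.image fun t => (D.star t, k t))
  refine ⟨gridDist allSplits.toFinset D.w D.rest, pos, Z,
    isSemimetric_gridDist (fun S hS => D.w_nonneg S (List.mem_toFinset.1 hS)) hrest, ?_, ?_, ?_, ?_⟩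
  · intro t t'
    simp only [gridDist, pos, D.proj_row, hκrow]
    rw [D.eq_add_sum t t', add_comm]
    congr 1
    refine sum_congr rfl fun S hS => ?_
    rw [List.mem_toFinset] at hS
    rcases (D.w_nonneg S hS).eq_or_lt with hw | hw
    · rw [← hw, zero_mul, zero_mul]
    · simp only [mem_A_row S hS hw, cutDist]
      by_cases h1 : t ∈ side S <;> by_cases h2 : t' ∈ side S <;> simp [h1, h2]
  · have h1 : ∀ e ∈ s, c e * gridDist allSplits.toFinset D.w D.rest (pos (f e)) (pos (g e)) =
        ∑ S ∈ allSplits.toFinset, D.w S * (c e *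
          |(if θ S < D.coord S (f e) then (1 : ℝ) else 0) -
            (if θ S < D.coord S (g e) then 1 else 0)|) +
        c e * D.rest (κ (D.proj (f e))) (κ (D.proj (g e))) := by
      intro e _
      simp only [gridDist, pos]
      rw [mul_add, mul_sum]
      congr 1
      refine sum_congr rfl fun S hS => ?_
      simp only [mem_A, List.mem_toFinset.1 hS, true_and]
      ring
    have h2 : ∀ S ∈ allSplits.toFinset, ∑ e ∈ s, D.w S * (c e *
          |(if θ S < D.coord S (f e) then (1 : ℝ) else 0) -
            (if θ S < D.coord S (g e) then 1 else 0)|) ≤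
        ∑ e ∈ s, c e * |D.coord S (f e) - D.coord S (g e)| := fun S hS => by
      rw [← mul_sum]
      exact (hθ S (List.mem_toFinset.1 hS)).2.2
    rw [sum_congr rfl h1, sum_add_distrib, sum_comm]
    refine (add_le_add (sum_le_sum h2) hκsum).trans (le_of_eq ?_)
    rw [sum_comm, ← sum_add_distrib]
    refine sum_congr rfl fun e _ => ?_
    rw [← mul_sum, ← mul_add]
    simp only [M']
    ring
  · have c1 : (univ.image fun i : Fin 5 => ((∅ : Finset (Fin 5 × Fin 5)), i)).card ≤ 5 :=
      card_image_le.trans (by simp)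
    have c2 : (univ.biUnion fun t => (D.star t).image fun S =>
        (({S} : Finset (Fin 5 × Fin 5)), k t)).card ≤ 10 := by
      refine card_biUnion_le.trans ?_
      refine (sum_le_sum fun t _ => card_image_le.trans (D.card_star_le hd t)).trans ?_
      simp
    have c3 : (univ.image fun t => (D.star t, k t)).card ≤ 5 := card_image_le.trans (by simp)
    have c4 := card_union_le (univ.image fun i : Fin 5 => ((∅ : Finset (Fin 5 × Fin 5)), i))
      ((univ.biUnion fun t => (D.star t).image fun S => (({S} : Finset (Fin 5 × Fin 5)), k t)) ∪
        univ.image fun t => (D.star t, k t))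
    have c5 := card_union_le
      (univ.biUnion fun t => (D.star t).image fun S => (({S} : Finset (Fin 5 × Fin 5)), k t))
      (univ.image fun t => (D.star t, k t))
    simp only [Z]
    omega
  · intro f hf
    by_cases hsingle : ∃ t, (t, t) ∈ A f
    · -- on the leg of a terminal all other coordinates are those of the terminal
      left
      obtain ⟨t, ht⟩ := hsingle
      have htL : (t, t) ∈ allSplits := ((mem_A f _).1 ht).1
      refine ⟨t, ?_⟩
      have hproj : D.proj f = D.rest t := by
        have := D.proj_add_proj (t, t) htL hf (coord_pos ht)
        rw [hrest.self] at this
        exact (D.tight_proj hf).eq_row hrest (by linarith)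
      have hA : A f = A (d t) := by
        ext S
        by_cases hS : S ∈ allSplits
        swap
        · simp [mem_A, hS]
        rcases mem_allSplits.1 hS with hSp | ⟨t', rfl⟩
        · have hcross := (List.pairwise_append.1 D.pairwise).2.2 (t, t) (mem_singleSplits t) S hSp
            f hf (coord_pos ht) Iff.rfl
          simp [mem_A, hcross]
        · by_cases htt : t' = t
          · subst htt
            simp only [ht, true_iff]
            rw [mem_A_row _ hS (w_pos hf ht)]
            exact left_mem_side _
          · have h1 : (t', t') ∉ A f := fun h => by
              obtain ⟨x, hx, hx'⟩ := inter f hf _ _ ht h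
              simp only [mem_side, or_self] at hx hx'
              exact htt (hx'.symm.trans hx)
            have h2 : (t', t') ∉ A (d t) := fun h => by
              have hw := w_pos (tight_row hd t) h
              rw [mem_A_row _ hS hw, mem_side] at h
              simp only [or_self] at h
              exact htt h.symm
            simp [h1, h2]
      simp only [pos, hA, hproj, D.proj_row]
    · right
      have hpair : ∀ {S}, S ∈ A f → S ∈ pairSplits := fun {S} hS => by
        rcases mem_allSplits.1 ((mem_A f S).1 hS).1 with h | ⟨t, rfl⟩
        · exact h
        · exact absurd ⟨t, hS⟩ hsingle
      have hstar : ∀ {S t}, S ∈ A f → t ∈ side S → S ∈ D.star t := fun {S t} hS ht =>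
        D.mem_star.2 ⟨hpair hS, w_pos hf hS, ht⟩
      have hκA : 0 < m → ∀ S ∈ A f, κ (D.proj f) ∈ side S := by
        intro hm S hS
        have h := (hκ.resolve_left fun h => hm.ne' h.1).2 _ (D.tight_proj hf)
        have hadd := D.proj_add_proj S ((mem_A f S).1 hS).1 hf (coord_pos hS)
        rw [mem_side]
        rcases D.mixed hK hm (hpair hS) (w_pos hf hS) with ⟨h1, h2, h3⟩ | ⟨h1, h2, h3⟩
        · exact h _ _ h1 h2 h3 hadd
        · rw [add_comm, hrest.symm] at hadd
          exact (h _ _ h1 h2 h3 hadd).symm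
      have hk : ∀ t, (0 < m → κ (D.proj f) = t) → κ (D.proj f) = k t := by
        intro t ht
        by_cases hm : 0 < m
        · simp only [k, hm, if_true, ht hm]
        · simp only [k, hm, if_false]
          exact (hκ.resolve_right fun h => hm h.1).2 _
      simp only [Z, mem_union, mem_image, mem_biUnion, mem_univ, true_and, pos, Prod.mk.injEq]
      rcases (A f).eq_empty_or_nonempty with h0 | ⟨S₁, h₁⟩
      · exact Or.inl ⟨_, h0.symm, rfl⟩
      right
      by_cases hone : ∀ S ∈ A f, S = S₁
      · left
        have hA : A f = {S₁} := eq_singleton_iff_unique_mem.2 ⟨h₁, hone⟩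
        by_cases hm : 0 < m
        · exact ⟨κ (D.proj f), S₁, hstar h₁ (hκA hm S₁ h₁), hA.symm, (hk _ fun _ => rfl).symm⟩
        · exact ⟨S₁.1, S₁, hstar h₁ (left_mem_side S₁), hA.symm, (hk _ fun h => absurd h hm).symm⟩
      · right
        push Not at hone
        obtain ⟨S₂, h₂, hne⟩ := hone
        obtain ⟨t, ht₁, ht₂⟩ := inter f hf _ _ h₁ h₂
        have hsub : A f ⊆ D.star t := fun S hS => hstar hS
          (D.mem_side_of_inter hd (hstar h₁ ht₁) (hstar h₂ ht₂) hne.symm (hpair hS) (w_pos hf hS)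
            (inter f hf _ _ h₁ hS) (inter f hf _ _ h₂ hS))
        have hcard : 1 < (A f).card := one_lt_card.2 ⟨S₁, h₁, S₂, h₂, hne.symm⟩
        have hA : A f = D.star t :=
          eq_of_subset_of_card_le hsub ((D.card_star_le hd t).trans hcard)
        refine ⟨t, hA.symm, (hk t fun hm => ?_).symm⟩
        by_contra hκt
        exact hne.symm (eq_of_mem_side (hpair h₁) (hpair h₂) hκt ht₁ (hκA hm S₁ h₁) ht₂
          (hκA hm S₂ h₂))

end Core

/-! ### Solutions from labellings -/

section Labelling

theorem walkLength_append {V : Type*} {G : SimpleGraph V} (len : Sym2 V → ℝ) {u v w : V}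
    (p : G.Walk u v) (q : G.Walk v w) :
    walkLength len (p.append q) = walkLength len p + walkLength len q := by
  simp [walkLength, SimpleGraph.Walk.edges_append]

variable {V : Type*} [Fintype V] [DecidableEq V]

theorem Instance.dist_comm (I : Instance V) (u v : V) : I.dist u v = I.dist v u :=
  pathDist_comm I.graph I.len u v

/-- The sums over the edges, written with a chosen orientation of each edge. -/
theorem Instance.exists_edgeSum_eq (I : Instance V) :
    ∃ s : Finset (Sym2 V), (∀ e, e ∈ s ↔ e ∈ I.graph.edgeSet) ∧
      (∀ w hw, I.edgeSum w hw = ∑ e ∈ s, I.cap e * w e.out.1 e.out.2) ∧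
      I.distSum = ∑ e ∈ s, I.cap e * I.dist e.out.1 e.out.2 := by
  classical
  have H : ∀ w hw, I.edgeSum w hw = ∑ e ∈ I.graph.edgeFinset, I.cap e * w e.out.1 e.out.2 := by
    intro w hw
    unfold Instance.edgeSum
    refine sum_congr (by ext; simp) fun e _ => congrArg (I.cap e * ·) ?_
    conv_lhs => rw [← Quot.out_eq e]
    rfl
  exact ⟨I.graph.edgeFinset, fun e => by simp, H, H _ I.dist_comm⟩

theorem walkLength_nonneg (I : Instance V) {u v : V} (p : I.graph.Walk u v) :
    0 ≤ walkLength I.len p := by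
  refine List.sum_nonneg fun x hx => ?_
  obtain ⟨e, he, rfl⟩ := List.mem_map.1 hx
  exact I.len_nonneg e (p.edges_subset_edgeSet he)

theorem Instance.dist_nonneg (I : Instance V) (u v : V) : 0 ≤ I.dist u v :=
  Real.iInf_nonneg fun p => walkLength_nonneg I p

theorem Instance.dist_le_walkLength (I : Instance V) {u v : V} (p : I.graph.Walk u v) :
    I.dist u v ≤ walkLength I.len p :=
  ciInf_le ⟨0, by rintro _ ⟨q, rfl⟩; exact walkLength_nonneg I q⟩ p

theorem Instance.dist_self (I : Instance V) (u : V) : I.dist u u = 0 :=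
  le_antisymm ((I.dist_le_walkLength .nil).trans (by simp [walkLength])) (I.dist_nonneg u u)

theorem Instance.dist_triangle (I : Instance V) {u v w : V} (huv : I.graph.Reachable u v)
    (hvw : I.graph.Reachable v w) : I.dist u w ≤ I.dist u v + I.dist v w := by
  have : Nonempty (I.graph.Walk u v) := huv
  have : Nonempty (I.graph.Walk v w) := hvw
  have h : ∀ p : I.graph.Walk u v, I.dist u w - walkLength I.len p ≤ I.dist v w := fun p =>
    le_ciInf fun q => by
      have := I.dist_le_walkLength (p.append q)
      rw [walkLength_append] at this
      linarith
  have : I.dist u w - I.dist v w ≤ I.dist u v := le_ciInf fun p => by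
    have := h p
    linarith
  linarith

/-- A labelling of the vertices by points of a semimetric space gives a solution, whose clusters are
the sets of vertices with the same label. -/
theorem exists_solution_of_label (I : Instance V) {X : Type*} [DecidableEq X] {δ : X → X → ℝ}
    (hδ : IsSemimetric δ) (label : V → X)
    (hsep : ∀ t ∈ I.terminals, ∀ t' ∈ I.terminals, label t = label t' → t = t')
    (hpres : ∀ t ∈ I.terminals, ∀ t' ∈ I.terminals, δ (label t) (label t') = I.dist t t') :
    ∃ S : Solution I, S.size ≤ (univ.image label).card ∧
      S.cost = I.edgeSum (fun u v => δ (label u) (label v)) fun _ _ => hδ.symm _ _ := by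
  classical
  let F : Finpartition (univ : Finset V) := Finpartition.ofSetoid (Setoid.ker label)
  have hF : ∀ u v, v ∈ F.part u ↔ label u = label v := fun u v =>
    Finpartition.mem_part_ofSetoid_iff_rel
  -- a representative of each cluster
  have hrep : ∀ A : {A : Finset V // A ∈ F.parts}, ∃ u, cluster F u = A := fun A => by
    obtain ⟨u, hu⟩ := F.nonempty_of_mem_parts A.2
    exact ⟨u, Subtype.ext (F.part_eq_of_mem A.2 hu)⟩
  choose rep hrep using hrep
  have hlabel : ∀ u, label (rep (cluster F u)) = label u := fun u => by
    have h1 : F.part (rep (cluster F u)) = F.part u := congrArg Subtype.val (hrep (cluster F u))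
    have h2 : u ∈ F.part u := (hF u u).2 rfl
    rw [← h1] at h2
    exact (hF _ _).1 h2
  have hcluster : ∀ u v, cluster F u = cluster F v → label u = label v := fun u v h => by
    rw [← hlabel u, h, hlabel v]
  let S : Solution I :=
    { F := F
      δ := fun A B => δ (label (rep A)) (label (rep B))
      semimetric := ⟨fun _ _ => hδ.nonneg _ _, fun _ => hδ.self _, fun _ _ => hδ.symm _ _,
        fun _ _ _ => hδ.triangle _ _ _⟩
      separates := fun t ht t' ht' hne h => hne (hsep t ht t' ht' (hcluster t t' h))
      preserves := fun t ht t' ht' => by rw [hlabel, hlabel, hpres t ht t' ht'] }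
  refine ⟨S, ?_, ?_⟩
  · have hinj : Function.Injective fun A : {A : Finset V // A ∈ F.parts} => label (rep A) := by
      intro A B h
      have h1 : F.part (rep A) = F.part (rep B) := by
        have : rep B ∈ F.part (rep A) := (hF _ _).2 h
        exact (F.part_eq_of_mem (F.part_mem.2 (mem_univ _)) this).symm
      rw [← hrep A, ← hrep B]
      exact Subtype.ext h1
    show F.parts.card ≤ _
    rw [← card_attach, ← card_image_of_injective _ hinj]
    refine card_le_card fun x hx => ?_
    obtain ⟨A, -, rfl⟩ := mem_image.1 hx
    exact mem_image_of_mem _ (mem_univ _)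
  · simp only [Solution.cost, S, hlabel]

/-- A labelling that does not cost too much can be made to cost exactly as much as the shortest-path
distance, by moving one vertex with a new label away from all others. -/
theorem exists_solution_of_label_le (I : Instance V) {X : Type*} [DecidableEq X] {δ : X → X → ℝ}
    (hδ : IsSemimetric δ) (label : V → X)
    (hsep : ∀ t ∈ I.terminals, ∀ t' ∈ I.terminals, label t = label t' → t = t')
    (hpres : ∀ t ∈ I.terminals, ∀ t' ∈ I.terminals, δ (label t) (label t') = I.dist t t')
    (hle : I.edgeSum (fun u v => δ (label u) (label v)) (fun _ _ => hδ.symm _ _) ≤ I.distSum) :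
    ∃ S : Solution I, S.size ≤ (univ.image label).card + 1 ∧ S.cost = I.distSum := by
  obtain ⟨s, hs, hsum, hdist⟩ := I.exists_edgeSum_eq
  by_cases h : ∃ e ∈ s, 0 < I.cap e ∧ ∃ u ∈ e, u ∉ I.terminals
  · obtain ⟨e₀, he₀, hcap, u, hu, huT⟩ := h
    let χ : Bool → ℝ := fun b => if b then 1 else 0
    let δ' : ℝ → X × Bool → X × Bool → ℝ := fun K x y => δ x.1 y.1 + K * |χ x.2 - χ y.2|
    have hδ' : ∀ K, 0 ≤ K → IsSemimetric (δ' K) := fun K hK =>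
      ⟨fun x y => add_nonneg (hδ.nonneg _ _) (mul_nonneg hK (abs_nonneg _)),
        fun x => by simp [δ', hδ.self], fun x y => by simp only [δ', hδ.symm x.1, abs_sub_comm],
        fun x y z => by
          have h1 := hδ.triangle x.1 y.1 z.1
          have h2 := mul_le_mul_of_nonneg_left (abs_sub_le (χ x.2) (χ y.2) (χ z.2)) hK
          simp only [δ']
          linarith⟩
    let label' : V → X × Bool := fun v => (label v, decide (v = u))
    let B := ∑ e ∈ s, I.cap e * |χ (label' e.out.1).2 - χ (label' e.out.2).2|
    have hterm : ∀ e ∈ s, 0 ≤ I.cap e * |χ (label' e.out.1).2 - χ (label' e.out.2).2| :=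
      fun e he => mul_nonneg (I.cap_nonneg e ((hs e).1 he)) (abs_nonneg _)
    have hB : 0 < B := by
      refine sum_pos' hterm ⟨e₀, he₀, mul_pos hcap ?_⟩
      have heq : s(e₀.out.1, e₀.out.2) = e₀ := Quot.out_eq e₀
      have hadj : I.graph.Adj e₀.out.1 e₀.out.2 := by
        rw [← SimpleGraph.mem_edgeSet, heq]
        exact (hs e₀).1 he₀
      rw [← heq, Sym2.mem_iff] at hu
      rcases hu with rfl | rfl
      · simp [label', χ, hadj.ne.symm]
      · simp [label', χ, hadj.ne]
    let K := (I.distSum - I.edgeSum (fun u v => δ (label u) (label v)) fun _ _ => hδ.symm _ _) / B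
    have hK : 0 ≤ K := div_nonneg (sub_nonneg.2 hle) hB.le
    have hlab : ∀ t ∈ I.terminals, label' t = (label t, false) := fun t ht => by
      have : t ≠ u := fun h => huT (h ▸ ht)
      simp [label', this]
    obtain ⟨S, hsize, hcost⟩ := exists_solution_of_label I (hδ' K hK) label'
      (fun t ht t' ht' h => hsep t ht t' ht' (congrArg Prod.fst h))
      (fun t ht t' ht' => by rw [hlab t ht, hlab t' ht']; simpa [δ'] using hpres t ht t' ht')
    refine ⟨S, hsize.trans ?_, ?_⟩
    · have hsub : univ.image label' ⊆
          insert (label u, true) ((univ.image label).image fun x => (x, false)) := by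
        intro x hx
        obtain ⟨v, -, rfl⟩ := mem_image.1 hx
        by_cases hv : v = u
        · simp [label', hv]
        · simp [label', hv]
      exact (card_le_card hsub).trans ((card_insert_le _ _).trans
        (Nat.add_le_add_right card_image_le 1))
    · have h1 : S.cost = I.edgeSum (fun u v => δ (label u) (label v)) (fun _ _ => hδ.symm _ _) +
          K * B := by
        rw [hcost, hsum, hsum, mul_sum, ← sum_add_distrib]
        refine sum_congr rfl fun e _ => ?_
        simp only [δ', label']
        ring
      rw [h1, div_mul_cancel₀ _ hB.ne']
      ring
  · push Not at h
    obtain ⟨S, hsize, hcost⟩ := exists_solution_of_label I hδ label hsep hpres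
    refine ⟨S, hsize.trans (Nat.le_succ _), ?_⟩
    rw [hcost, hdist, hsum]
    refine sum_congr rfl fun e he => ?_
    rcases (I.cap_nonneg e ((hs e).1 he)).eq_or_lt with h0 | h0
    · rw [← h0, zero_mul, zero_mul]
    · rw [hpres _ (h e he h0 _ (Sym2.out_fst_mem e)) _ (h e he h0 _ (Sym2.out_snd_mem e))]

theorem exists_terminal_enumeration (I : Instance V) (hT : I.terminals.card ≤ 5)
    (hne : I.terminals.Nonempty) :
    ∃ τ : Fin 5 → V, (∀ i, τ i ∈ I.terminals) ∧ ∀ t ∈ I.terminals, ∃ i, τ i = t := by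
  obtain ⟨t₀, ht₀⟩ := hne
  refine ⟨fun i => I.terminals.toList.getD i t₀, fun i => ?_, fun t ht => ?_⟩
  · show I.terminals.toList.getD i t₀ ∈ I.terminals
    by_cases h : (i : ℕ) < I.terminals.toList.length
    · rw [List.getD_eq_getElem _ _ h, ← mem_toList]
      exact List.getElem_mem h
    · rw [List.getD_eq_default _ _ (not_lt.1 h)]
      exact ht₀
  · obtain ⟨n, hn, rfl⟩ := List.getElem_of_mem (mem_toList.2 ht)
    have hn5 : n < 5 := hn.trans_le (by rwa [length_toList])
    exact ⟨⟨n, hn5⟩, List.getD_eq_getElem _ _ hn⟩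

end Labelling

end ZeroExt

open ZeroExt Finset in
theorem theorem3p2 {V : Type*} [Fintype V] [DecidableEq V] (I : ZeroExt.Instance V)
    (hT : I.terminals.card ≤ 5) :
    ∃ S : ZeroExt.Solution I, S.size ≤ 30 ∧ S.cost = I.distSum := by
  classical
  obtain ⟨s, hs, hsum, hdist⟩ := I.exists_edgeSum_eq
  have hcap : ∀ e ∈ s, 0 ≤ I.cap e := fun e he => I.cap_nonneg e ((hs e).1 he)
  rcases I.terminals.eq_empty_or_nonempty with hempty | hne
  · have hzero : IsSemimetric fun _ _ : Unit => (0 : ℝ) := by constructor <;> simp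
    obtain ⟨S, hsize, hcost⟩ := exists_solution_of_label_le I hzero (fun _ => ())
      (by simp [hempty]) (by simp [hempty]) (by
        rw [hdist, hsum]
        exact sum_le_sum fun e he => mul_le_mul_of_nonneg_left (I.dist_nonneg _ _) (hcap e he))
    refine ⟨S, hsize.trans ?_, hcost⟩
    have : (univ.image fun _ : V => ()).card ≤ 1 := card_le_one.2 (by simp)
    omega
  obtain ⟨τ, hτ, hτsurj⟩ := exists_terminal_enumeration I hT hne
  have hreach : ∀ i j, I.graph.Reachable (τ i) (τ j) := fun i j => I.reachable _ (hτ i) _ (hτ j)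
  let d : Fin 5 → Fin 5 → ℝ := fun i j => I.dist (τ i) (τ j)
  have hd : IsSemimetric d := ⟨fun _ _ => I.dist_nonneg _ _, fun _ => I.dist_self _,
    fun _ _ => I.dist_comm _ _, fun i j k => I.dist_triangle (hreach i j) (hreach j k)⟩
  -- a vertex in a component without terminals may be mapped to any point of the tight span
  let φ : V → Fin 5 → ℝ := fun v =>
    if I.graph.Reachable v (τ 0) then fun i => I.dist v (τ i) else d 0
  have hφ : ∀ v i j, d i j ≤ φ v i + φ v j := by
    intro v i j
    by_cases hv : I.graph.Reachable v (τ 0)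
    · simp only [φ, hv, if_true, d]
      rw [I.dist_comm v (τ i)]
      exact I.dist_triangle ((hreach i 0).trans hv.symm) (hv.trans (hreach 0 j))
    · simp only [φ, hv, if_false]
      exact (tight_row hd 0).le i j
  have hφτ : ∀ i, φ (τ i) = d i := fun i => by simp [φ, hreach i 0, d]
  have hφlip : ∀ u v, I.graph.Adj u v → ∀ i, |φ u i - φ v i| ≤ I.dist u v := by
    intro u v huv i
    by_cases hv : I.graph.Reachable v (τ 0)
    · have hu : I.graph.Reachable u (τ 0) := huv.reachable.trans hv
      simp only [φ, hu, hv, if_true]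
      have h1 := I.dist_triangle huv.reachable (hv.trans (hreach 0 i))
      have h2 := I.dist_triangle huv.reachable.symm (hu.trans (hreach 0 i))
      rw [I.dist_comm v u] at h2
      rw [abs_le]
      constructor <;> linarith
    · have hu : ¬I.graph.Reachable u (τ 0) := fun h => hv (huv.reachable.symm.trans h)
      simp [φ, hu, hv, I.dist_nonneg]
  obtain ⟨R, hR, hRfix, hRlip⟩ := exists_retraction hd
  have hadj : ∀ e ∈ s, I.graph.Adj e.out.1 e.out.2 := fun e he => by
    have heq : s(e.out.1, e.out.2) = e := Quot.out_eq e
    rw [← SimpleGraph.mem_edgeSet, heq]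
    exact (hs e).1 he
  obtain ⟨δ, pos, Z, hδ, hδd, hδsum, hZ, hpos⟩ := exists_tightSpan_rounding hd s I.cap
    (fun e => I.dist e.out.1 e.out.2) hcap (fun e => R (φ e.out.1)) (fun e => R (φ e.out.2))
    (fun _ _ => hR _ (hφ _)) (fun _ _ => hR _ (hφ _))
    (fun e he => hRlip _ _ _ (hφlip _ _ (hadj e he)))
  -- the grid points at the terminals get several labels, as terminals may be at distance zero
  let place : Fin 5 ⊕ (Finset (Fin 5 × Fin 5) × Fin 5) → Finset (Fin 5 × Fin 5) × Fin 5 :=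
    Sum.elim (fun i => pos (d i)) id
  have hlabel : ∀ v, ∃ x, place x = pos (R (φ v)) ∧
      (v ∈ I.terminals → ∃ i, x = Sum.inl i ∧ τ i = v) ∧
      x ∈ univ.image Sum.inl ∪ Z.image Sum.inr := by
    intro v
    by_cases hv : v ∈ I.terminals
    · obtain ⟨i, rfl⟩ := hτsurj v hv
      refine ⟨Sum.inl i, ?_, fun _ => ⟨i, rfl, rfl⟩, by simp⟩
      simp [place, hφτ, hRfix _ (tight_row hd i)]
    · rcases hpos _ (hR _ (hφ v)) with ⟨i, hi⟩ | h
      · exact ⟨Sum.inl i, by simp [place, hi], fun h => absurd h hv, by simp⟩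
      · exact ⟨Sum.inr (pos (R (φ v))), by simp [place], fun h => absurd h hv, by simp [h]⟩
  choose label hplace hterm hmem using hlabel
  have hδplace : IsSemimetric fun x y => δ (place x) (place y) :=
    ⟨fun _ _ => hδ.nonneg _ _, fun _ => hδ.self _, fun _ _ => hδ.symm _ _,
      fun _ _ _ => hδ.triangle _ _ _⟩
  obtain ⟨S, hsize, hcost⟩ := exists_solution_of_label_le I hδplace label
    (fun t ht t' ht' h => by
      obtain ⟨i, hi, rfl⟩ := hterm t ht
      obtain ⟨j, hj, rfl⟩ := hterm t' ht'
      rw [hi, hj] at h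
      rw [Sum.inl_injective h])
    (fun t ht t' ht' => by
      obtain ⟨i, rfl⟩ := hτsurj t ht
      obtain ⟨j, rfl⟩ := hτsurj t' ht'
      simp only [hplace, hφτ, hRfix _ (tight_row hd _), hδd, d])
    (by
      rw [hdist, hsum]
      simpa only [hplace] using hδsum)
  refine ⟨S, hsize.trans ?_, hcost⟩
  have h1 : (univ.image label).card ≤ (univ.image Sum.inl ∪ Z.image Sum.inr).card :=
    card_le_card fun x hx => by
      obtain ⟨v, -, rfl⟩ := mem_image.1 hx
      exact hmem v
  have h2 := card_union_le
    (univ.image (Sum.inl : Fin 5 → Fin 5 ⊕ (Finset (Fin 5 × Fin 5) × Fin 5))) (Z.image Sum.inr)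
  have h3 : (univ.image
      (Sum.inl : Fin 5 → Fin 5 ⊕ (Finset (Fin 5 × Fin 5) × Fin 5))).card ≤ 5 :=
    card_image_le.trans (by simp)
  have h4 : (Z.image (Sum.inr : _ → Fin 5 ⊕ (Finset (Fin 5 × Fin 5) × Fin 5))).card ≤ 20 :=
    card_image_le.trans hZ
  omega
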